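/- Let $c\in\mathbb C$, $g(x,y)=\frac{c}{x-y}$, $f(x,y)=1+g(x,y)$, let $\mathcal H$ be a complex vector space, and let $T(u)=(T_{ij}(u))_{i,j=1}^3$, $u\in S\subseteq\mathbb C$, be a matrix of operators on $\mathcal H$ satisfying, for all $u\neq v$ in $S$, $$R(u,v)\,(T(u)\otimes I)(I\otimes T(v))=(I\otimes T(v))(T(u)\otimes I)\,R(u,v),\qquad R(u,v)=\mathbb I+g(u,v)P,$$ where $P$ is the permutation of $\mathbb C^3\otimes\mathbb C^3$. Let $|0\rangle\in\mathcal H$ and functions $\lambda_1,\lambda_2,\lambda_3$ be such that $T_{ii}(u)|0\rangle=\lambda_i(u)|0\rangle$ and $T_{ij}(u)|0\rangle=0$ for $i>j$, for all $u\in S$. Let $\bar u=\{u_1,\dots,u_a\}\subset S$ and $\bar v=\{v_1,\dots,v_b\}\subset S$ ($a,b\ge 0$), all these $a+b$ numbers being pairwise distinct. Put $\mathbb B(u)=(T_{12}(u),T_{13}(u))$, $\mathbb D(u)=(T_{i+1,j+1}(u))_{i,j=1}^{2}$, $r(u,v)=\mathbf 1+g(u,v)\mathbf p$ with $\mathbf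 p$ the permutation of $\mathbb C^2\otimes\mathbb C^2$, and let $\widehat{\mathcal B}(z)$ be the upper right entry, with respect to the auxiliary space $V_0=\mathbb C^2$, of $$\mathbb D_0(z)\,r_{0a}(z,u_a)\cdots r_{01}(z,u_1),$$ acting in $\mathcal H\otimes V_1\otimes\dots\otimes V_a$, $V_k=\mathbb C^2$. With $|\Omega\rangle=\binom10^{\otimes a}$ define $$\mathbb F(\bar u;\bar v)|0\rangle=\widehat{\mathcal B}(v_1)\cdots\widehat{\mathcal B}(v_b)\,|0\rangle\otimes|\Omega\rangle,\qquad |\Psi_{a,b}(\bar u;\bar v)\rangle=\mathbb B_1(u_1)\cdots\mathbb B_a(u_a)\,\mathbb F(\bar u;\bar v)|0\rangle,$$ $$|\Phi_{a,b}(z,u_1;\bar u;\bar v)\rangle=\mathbb B_1(z)\mathbb B_2(u_2)\cdots\mathbb B_a(u_a)\,\mathbb F(\bar u;\bar v)|0\rangle,\qquad |\Phi_{a,b}(z,u_k;\bar u;\bar v)\rangle=|\Phi_{a,b}(z,u_1;\bar u;\bar v)\rangle\big|_{u_1\leftrightarrow u_k}.$$ A function with a set as an argument stands for the product over that set (an empty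 product is $1$), and $\bar u_k=\bar u\setminus\{u_k\}$, $\bar v_j=\bar v\setminus\{v_j\}$. Consider the nested Bethe equations $$\text{(U)}\quad \frac{\lambda_1(u_k)}{\lambda_2(u_k)}=\frac{f(u_k,\bar u_k)}{f(\bar u_k,u_k)}\,f(\bar v,u_k),\quad k=1,\dots,a,\qquad\qquad \text{(V)}\quad \frac{\lambda_2(v_j)}{\lambda_3(v_j)}=\frac{f(v_j,\bar v_j)}{f(\bar v_j,v_j)}\,\frac1{f(v_j,\bar u)},\quad j=1,\dots,b,$$ understood with denominators cleared, i.e. $\lambda_1(u_k)f(\bar u_k,u_k)=\lambda_2(u_k)f(u_k,\bar u_k)f(\bar v,u_k)$ and $\lambda_2(v_j)f(\bar v_j,v_j)f(v_j,\bar u)=\lambda_3(v_j)f(v_j,\bar v_j)$. Assume that (V) holds. Then: 1. For all $z\in S\setminus(\bar u\cup\bar v)$, $$\operatorname{tr}T(z)\,|\Psi_{a,b}(\bar u;\bar v)\rangle=\widehat\tau(z|\bar u;\bar v)\,|\Psi_{a,b}(\bar u;\bar v)\rangle+\sum_{k=1}^a\widehat M_k\,|\Phi_{a,b}(z,u_k;\bar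 u;\bar v)\rangle,$$ where $$\widehat\tau(z|\bar u;\bar v)=\lambda_1(z)f(\bar u,z)+\lambda_2(z)f(z,\bar u)f(\bar v,z)+\lambda_3(z)f(z,\bar v),$$ $$\widehat M_k=\lambda_1(u_k)g(z,u_k)f(\bar u_k,u_k)+\lambda_2(u_k)g(u_k,z)f(u_k,\bar u_k)f(\bar v,u_k).$$ 2. If $c\ne0$ then, for every $z\in\mathbb C\setminus\bar u$, one has $\widehat M_k=0$ for all $k=1,\dots,a$ if and only if (U) holds. 3. If (U) holds as well, then $\operatorname{tr}T(z)|\Psi_{a,b}(\bar u;\bar v)\rangle=\widehat\tau(z|\bar u;\bar v)|\Psi_{a,b}(\bar u;\bar v)\rangle$ for all $z\in S\setminus(\bar u\cup\bar v)$; so $|\Psi_{a,b}(\bar u;\bar v)\rangle$, when it is nonzero, is an eigenvector of $\operatorname{tr}T(z)$ with eigenvalue $\widehat\tau(z|\bar u;\bar v)$. -/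

import Mathlib

open scoped Kronecker

noncomputable section

namespace NABA

/-- The rational function `g(x,y) = c / (x - y)`. -/
def g (c x y : ℂ) : ℂ := c / (x - y)

/-- The rational function `f(x,y) = 1 + g(x,y) = (x - y + c) / (x - y)`. -/
def f (c x y : ℂ) : ℂ := 1 + g c x y

/-- The permutation matrix `P = ∑ E_{ij} ⊗ E_{ji}` on `ℂⁿ ⊗ ℂⁿ`. -/
def permMatrix (n : ℕ) : Matrix (Fin n × Fin n) (Fin n × Fin n) ℂ :=
  Matrix.of fun p q => if p.1 = q.2 ∧ p.2 = q.1 then 1 else 0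

/-- The `gl_n`-invariant `R`-matrix `R(u,v) = 1 + g(u,v) P` on `ℂⁿ ⊗ ℂⁿ`. -/
def RMatrix (n : ℕ) (c u v : ℂ) : Matrix (Fin n × Fin n) (Fin n × Fin n) ℂ :=
  1 + g c u v • permMatrix n

section Model

variable {H : Type*} [AddCommGroup H] [Module ℂ H]

/-- The relation `R(u,v) (T(u) ⊗ I) (I ⊗ T(v)) = (I ⊗ T(v)) (T(u) ⊗ I) R(u,v)` for all distinct
`u`, `v` in the domain `S` of the operator-valued matrix `T`. -/
def RTT {n : ℕ} (c : ℂ) (S : Set ℂ) (T : ℂ → Matrix (Fin n) (Fin n) (Module.End ℂ H)) : Prop :=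
  ∀ u ∈ S, ∀ v ∈ S, u ≠ v →
    (RMatrix n c u v).map (algebraMap ℂ (Module.End ℂ H)) *
        (T u ⊗ₖ (1 : Matrix (Fin n) (Fin n) (Module.End ℂ H))) *
        ((1 : Matrix (Fin n) (Fin n) (Module.End ℂ H)) ⊗ₖ T v) =
      ((1 : Matrix (Fin n) (Fin n) (Module.End ℂ H)) ⊗ₖ T v) *
        (T u ⊗ₖ (1 : Matrix (Fin n) (Fin n) (Module.End ℂ H))) *
        (RMatrix n c u v).map (algebraMap ℂ (Module.End ℂ H))

/-- A `gl_3`-invariant model: a `3 × 3` monodromy matrix with the `RTT`-relation and a vacuum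
vector. The indices `1, 2, 3` of the mathematics are `0, 1, 2` in `Fin 3`. -/
structure IsGL3Model (c : ℂ) (S : Set ℂ) (T : ℂ → Matrix (Fin 3) (Fin 3) (Module.End ℂ H))
    (vac : H) (lam : Fin 3 → ℂ → ℂ) : Prop where
  rtt : RTT c S T
  diag : ∀ u ∈ S, ∀ i, T u i i vac = lam i u • vac
  lower : ∀ u ∈ S, ∀ i j, j < i → T u i j vac = 0

/-- The transfer matrix `tr T(z) = T₁₁(z) + T₂₂(z) + T₃₃(z)`. -/
def transfer (T : ℂ → Matrix (Fin 3) (Fin 3) (Module.End ℂ H)) (z : ℂ) : Module.End ℂ H :=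
  (T z).trace

/-- The row `𝔹(u) = (T₁₂(u), T₁₃(u))`. -/
def blockB (T : ℂ → Matrix (Fin 3) (Fin 3) (Module.End ℂ H)) (u : ℂ) (β : Fin 2) :
    Module.End ℂ H :=
  T u 0 β.succ

/-- The lower right block `𝔻(u)`, with entries `T_{ij}(u)`, `i, j ∈ {2, 3}`. -/
def blockD (T : ℂ → Matrix (Fin 3) (Fin 3) (Module.End ℂ H)) (u : ℂ) :
    Matrix (Fin 2) (Fin 2) (Module.End ℂ H) :=
  (T u).submatrix Fin.succ Fin.succ

/-- The space `H ⊗ (ℂ²)^{⊗ a}`: the vector `x` stands for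
`∑ s, x s ⊗ e_{s 1} ⊗ ⋯ ⊗ e_{s a}`, where `e_0`, `e_1` is the standard basis of `ℂ²`. -/
abbrev AuxSpace (H : Type*) (a : ℕ) : Type _ := (Fin a → Fin 2) → H

/-- The standard basis matrix `E_{αβ}` acting in the `k`-th factor `ℂ²` of
`H ⊗ (ℂ²)^{⊗ a}`. -/
def siteE {a : ℕ} (k : Fin a) (α β : Fin 2) : Module.End ℂ (AuxSpace H a) where
  toFun x s := if s k = α then x (Function.update s k β) else 0
  map_add' x y := by
    funext s
    by_cases h : s k = α <;> simp [h]
  map_smul' r x := by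
    funext s
    by_cases h : s k = α <;> simp [h]

/-- `r_{0k}(z,w) = 1 + g(z,w) p_{0k}`, as a `2 × 2` matrix in the auxiliary space `V₀` whose
entries act in the `k`-th factor; the `(α,β)` entry of `p_{0k} = ∑ E_{αβ} ⊗ E_{βα}` is `E_{βα}`. -/
def siteR {a : ℕ} (c : ℂ) (k : Fin a) (z w : ℂ) :
    Matrix (Fin 2) (Fin 2) (Module.End ℂ (AuxSpace H a)) :=
  1 + Matrix.of fun α β => g c z w • siteE k β α

/-- The nested monodromy matrix `𝔻₀(z) r_{0a}(z,u_a) ⋯ r_{01}(z,u_1)`. -/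
def nestedT {a : ℕ} (c : ℂ) (T : ℂ → Matrix (Fin 3) (Fin 3) (Module.End ℂ H))
    (u : Fin a → ℂ) (z : ℂ) : Matrix (Fin 2) (Fin 2) (Module.End ℂ (AuxSpace H a)) :=
  ((blockD T z).map fun X => X.compLeft (Fin a → Fin 2)) *
    (List.ofFn fun k => siteR c k z (u k)).reverse.prod

/-- The creation operator of the nested monodromy matrix: its upper right entry. -/
def nestedB {a : ℕ} (c : ℂ) (T : ℂ → Matrix (Fin 3) (Fin 3) (Module.End ℂ H))
    (u : Fin a → ℂ) (z : ℂ) : Module.End ℂ (AuxSpace H a) :=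
  nestedT c T u z 0 1

/-- The nested vacuum `|0⟩ ⊗ e_0 ⊗ ⋯ ⊗ e_0`. -/
def nestedVac (a : ℕ) (vac : H) : AuxSpace H a :=
  fun s => if s = 0 then vac else 0

/-- The nested Bethe vector `𝔽(ū;v̄)|0⟩`, equal to the product of the creation operators at
`v_1, …, v_b`, in this order, applied to the nested vacuum. -/
def nestedVector {a b : ℕ} (c : ℂ) (T : ℂ → Matrix (Fin 3) (Fin 3) (Module.End ℂ H)) (vac : H)
    (u : Fin a → ℂ) (v : Fin b → ℂ) : AuxSpace H a :=
  (List.ofFn fun j => nestedB c T u (v j)).prod (nestedVac a vac)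

/-- `𝔹₁(w_1) ⋯ 𝔹_a(w_a) x = ∑_β B_{β_1}(w_1) ⋯ B_{β_a}(w_a) x_β`. -/
def rowApply {a : ℕ} (T : ℂ → Matrix (Fin 3) (Fin 3) (Module.End ℂ H)) (w : Fin a → ℂ)
    (x : AuxSpace H a) : H :=
  ∑ β : Fin a → Fin 2, (List.ofFn fun k => blockB T (w k) (β k)).prod (x β)

/-- The off-shell Bethe vector `|Ψ_{a,b}(ū;v̄)⟩`. -/
def betheVector {a b : ℕ} (c : ℂ) (T : ℂ → Matrix (Fin 3) (Fin 3) (Module.End ℂ H)) (vac : H)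
    (u : Fin a → ℂ) (v : Fin b → ℂ) : H :=
  rowApply T u (nestedVector c T vac u v)

/-- The vector `|Φ_{a,b}(z,u_k;ū;v̄)⟩`: for `k = 1` it is
`𝔹₁(z) 𝔹₂(u_2) ⋯ 𝔹_a(u_a) 𝔽(ū;v̄)|0⟩`, and in general `u_1` and `u_k` are exchanged in that
expression. -/
def unwantedVector {a b : ℕ} (c : ℂ) (T : ℂ → Matrix (Fin 3) (Fin 3) (Module.End ℂ H)) (vac : H)
    (z : ℂ) (u : Fin a → ℂ) (v : Fin b → ℂ) (k : Fin a) : H :=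
  let first : Fin a := ⟨0, k.pos⟩
  let u' : Fin a → ℂ := u ∘ Equiv.swap first k
  rowApply T (Function.update u' first z) (nestedVector c T vac u' v)

end Model

/-- `λ₁(z) f(ū,z) + λ₂(z) f(z,ū) f(v̄,z) + λ₃(z) f(z,v̄)`. -/
def eigenvalue {a b : ℕ} (c : ℂ) (lam : Fin 3 → ℂ → ℂ) (u : Fin a → ℂ) (v : Fin b → ℂ)
    (z : ℂ) : ℂ :=
  lam 0 z * ∏ i, f c (u i) z
    + lam 1 z * (∏ i, f c z (u i)) * ∏ j, f c (v j) z
    + lam 2 z * ∏ j, f c z (v j)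

/-- `λ₁(u_k) g(z,u_k) f(ū_k,u_k) + λ₂(u_k) g(u_k,z) f(u_k,ū_k) f(v̄,u_k)`. -/
def unwantedCoeff {a b : ℕ} (c : ℂ) (lam : Fin 3 → ℂ → ℂ) (u : Fin a → ℂ) (v : Fin b → ℂ)
    (z : ℂ) (k : Fin a) : ℂ :=
  lam 0 (u k) * g c z (u k) * ∏ i ∈ Finset.univ.erase k, f c (u i) (u k)
    + lam 1 (u k) * g c (u k) z * (∏ i ∈ Finset.univ.erase k, f c (u k) (u i))
      * ∏ j, f c (v j) (u k)

/-- The Bethe equations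
`λ₁(u_k) / λ₂(u_k) = f(u_k,ū_k) / f(ū_k,u_k) * f(v̄,u_k)`, with denominators cleared. -/
def BetheEqU {a b : ℕ} (c : ℂ) (lam : Fin 3 → ℂ → ℂ) (u : Fin a → ℂ) (v : Fin b → ℂ) : Prop :=
  ∀ k, lam 0 (u k) * ∏ i ∈ Finset.univ.erase k, f c (u i) (u k)
    = lam 1 (u k) * (∏ i ∈ Finset.univ.erase k, f c (u k) (u i)) * ∏ j, f c (v j) (u k)

/-- The Bethe equations
`λ₂(v_j) / λ₃(v_j) = f(v_j,v̄_j) / f(v̄_j,v_j) * 1 / f(v_j,ū)`, with denominators cleared. -/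
def BetheEqV {a b : ℕ} (c : ℂ) (lam : Fin 3 → ℂ → ℂ) (u : Fin a → ℂ) (v : Fin b → ℂ) : Prop :=
  ∀ j, lam 1 (v j) * (∏ i ∈ Finset.univ.erase j, f c (v i) (v j)) * ∏ k, f c (v j) (u k)
    = lam 2 (v j) * ∏ i ∈ Finset.univ.erase j, f c (v j) (v i)

/-- Where the denominators do not vanish, `BetheEqU` is the quotient form. -/
theorem betheEqU_iff {a b : ℕ} (c : ℂ) (lam : Fin 3 → ℂ → ℂ) (u : Fin a → ℂ) (v : Fin b → ℂ)
    (h₂ : ∀ k, lam 1 (u k) ≠ 0)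
    (hf : ∀ k, ∏ i ∈ Finset.univ.erase k, f c (u i) (u k) ≠ 0) :
    BetheEqU c lam u v ↔ ∀ k, lam 0 (u k) / lam 1 (u k)
      = (∏ i ∈ Finset.univ.erase k, f c (u k) (u i))
          / (∏ i ∈ Finset.univ.erase k, f c (u i) (u k)) * ∏ j, f c (v j) (u k) := by
  refine forall_congr' fun k => ?_
  rw [div_mul_eq_mul_div, div_eq_div_iff (h₂ k) (hf k)]
  constructor <;> intro h <;> linear_combination h

/-- Where the denominators do not vanish, `BetheEqV` is the quotient form. -/
theorem betheEqV_iff {a b : ℕ} (c : ℂ) (lam : Fin 3 → ℂ → ℂ) (u : Fin a → ℂ) (v : Fin b → ℂ)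
    (h₃ : ∀ j, lam 2 (v j) ≠ 0)
    (hf : ∀ j, ∏ i ∈ Finset.univ.erase j, f c (v i) (v j) ≠ 0)
    (hu : ∀ j, ∏ k, f c (v j) (u k) ≠ 0) :
    BetheEqV c lam u v ↔ ∀ j, lam 1 (v j) / lam 2 (v j)
      = (∏ i ∈ Finset.univ.erase j, f c (v j) (v i))
          / (∏ i ∈ Finset.univ.erase j, f c (v i) (v j)) * (1 / ∏ k, f c (v j) (u k)) := by
  refine forall_congr' fun j => ?_
  rw [div_mul_div_comm, div_eq_div_iff (h₃ j) (mul_ne_zero (hf j) (hu j))]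
  constructor <;> intro h <;> linear_combination h

end NABA

end

open scoped Kronecker

noncomputable section

namespace NABA

/-! ### The exchange relation in components -/

/-! Write `tr T = T₁₁ + tr 𝔻` and move both summands to the right through `𝔹₁(u_1) ⋯ 𝔹_a(u_a)`.
Passing one factor `𝔹(p)` either keeps the arguments, which builds up the wanted term, or exchanges
`z` with `p`, which puts `z` into the row. For `T₁₁` the wanted term carries a scalar product of
`f`'s. For `𝔻` it carries the factors `r(z,u_k)`, so `𝔻` becomes the nested monodromy matrix. The
results are `T00_row` and `blockD_row`.

In the usual argument only the first unwanted term is computed, and the others follow from symmetry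
in `ū`. Here all of them come from one induction on `a`, for an arbitrary family `F(ū)` that is
`Covariant`: `P + g(u_i,u_j)`, on adjacent sites, exchanges `u_i` and `u_j` up to `f(u_i,u_j)`. Rows
obey the dual rule `row_twist`. These two rules and the identity `g_mul_g` merge the contributions
to each unwanted term. The nested Bethe vector is covariant because `P + g` intertwines the nested
monodromy matrices (Yang–Baxter).

What remains is the action on the nested vector. `T₁₁` acts by `λ₁`, as the vector is singular for
the first column of `T`. The nested monodromy matrix satisfies a rank-one exchange relation with
vacuum eigenvalues `λ₂(z) f(z,ū)` and `λ₃(z)`, so under (V) `bethe_rank_one` makes the nested vector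
an eigenvector of its trace. The `𝔻` part of an unwanted term involves the residue at `u_k`. No
analyticity is available, but the residue, defined algebraically, obeys the same exchange relation,
and the rank-one theorem applies to it as well (`residueT_trace_nestedVector`). -/

/-- The `RTT`-relation for two matrices, in components. -/
def Exchange {n : ℕ} {A : Type*} [Ring A] [Algebra ℂ A] (γ : ℂ)
    (M M' : Matrix (Fin n) (Fin n) A) : Prop :=
  ∀ i j k l, M i j * M' k l + γ • (M k j * M' i l) = M' k l * M i j + γ • (M' k j * M i l)

theorem RTT.exchange {H : Type*} [AddCommGroup H] [Module ℂ H] {n : ℕ} {c : ℂ} {S : Set ℂ}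
    {T : ℂ → Matrix (Fin n) (Fin n) (Module.End ℂ H)} (h : RTT c S T) {u v : ℂ} (hu : u ∈ S)
    (hv : v ∈ S) (huv : u ≠ v) : Exchange (g c u v) (T u) (T v) := by
  intro i j k l
  have h1 := congrFun (congrFun (h u hu v hv huv) (i, k)) (j, l)
  have hl : (T u ⊗ₖ (1 : Matrix (Fin n) (Fin n) (Module.End ℂ H))) *
        ((1 : Matrix (Fin n) (Fin n) (Module.End ℂ H)) ⊗ₖ T v) =
      Matrix.of fun p q => T u p.1 q.1 * T v p.2 q.2 := by
    ext1 p q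
    simp [Matrix.mul_apply, Fintype.sum_prod_type, Matrix.one_apply]
  have hr : ((1 : Matrix (Fin n) (Fin n) (Module.End ℂ H)) ⊗ₖ T v) *
        (T u ⊗ₖ (1 : Matrix (Fin n) (Fin n) (Module.End ℂ H))) =
      Matrix.of fun p q => T v p.2 q.2 * T u p.1 q.1 := by
    ext1 p q
    simp [Matrix.mul_apply, Fintype.sum_prod_type, Matrix.one_apply]
  have hR : (RMatrix n c u v).map (algebraMap ℂ (Module.End ℂ H)) =
      1 + g c u v • Matrix.of fun p q => if p.1 = q.2 ∧ p.2 = q.1 then 1 else 0 := by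
    ext1 p q
    simp only [Matrix.map_apply, RMatrix, Matrix.add_apply, Matrix.smul_apply, permMatrix,
      Matrix.of_apply, smul_eq_mul, map_add, map_mul, Matrix.one_apply,
      apply_ite (algebraMap ℂ (Module.End ℂ H)), map_one, map_zero]
    rw [Algebra.smul_def]
  rw [Matrix.mul_assoc, hl, hr, hR, add_mul, mul_add, one_mul, mul_one] at h1
  simpa [Matrix.mul_apply, Fintype.sum_prod_type, ite_and] using h1

theorem mul_mul_mul_apply_of_commute {n : ℕ} {A : Type*} [Ring A]
    {M M' L L' : Matrix (Fin n) (Fin n) A} (h : ∀ i j k l, Commute (M' i j) (L k l))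
    (i j k l : Fin n) :
    (M * L) i j * (M' * L') k l = ∑ p, ∑ q, (M i p * M' k q) * (L p j * L' q l) := by
  simp only [Matrix.mul_apply, Finset.sum_mul, Finset.mul_sum]
  rw [Finset.sum_comm]
  refine Finset.sum_congr rfl fun p _ => Finset.sum_congr rfl fun q _ => ?_
  rw [mul_assoc, mul_assoc, ← mul_assoc (L _ _), ← (h k _ _ j).eq, mul_assoc]

/-- This is the coproduct: as entries of different factors commute, the `R`-matrix can be carried
through the first pair of factors and then through the second. -/
theorem Exchange.mul {n : ℕ} {A : Type*} [Ring A] [Algebra ℂ A] {γ : ℂ}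
    {M M' L L' : Matrix (Fin n) (Fin n) A} (hM : Exchange γ M M') (hL : Exchange γ L L')
    (h : ∀ i j k l, Commute (M i j) (L' k l)) (h' : ∀ i j k l, Commute (M' i j) (L k l)) :
    Exchange γ (M * L) (M' * L') := by
  intro i j k l
  rw [mul_mul_mul_apply_of_commute h', mul_mul_mul_apply_of_commute h',
    mul_mul_mul_apply_of_commute h, mul_mul_mul_apply_of_commute h]
  calc _ = ∑ p, ∑ q, (M i p * M' k q + γ • (M k p * M' i q)) * (L p j * L' q l) := by
        simp only [add_mul, Finset.sum_add_distrib, Finset.smul_sum, smul_mul_assoc]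
    _ = ∑ p, ∑ q, (M' k q * M i p + γ • (M' k p * M i q)) * (L p j * L' q l) := by
        simp only [hM i _ k _]
    _ = ∑ q, ∑ p, (M' k q * M i p) * (L p j * L' q l + γ • (L q j * L' p l)) := by
        simp only [add_mul, mul_add, Finset.sum_add_distrib, smul_mul_assoc, mul_smul_comm]
        congr 1
        exact Finset.sum_comm
    _ = ∑ q, ∑ p, (M' k q * M i p) * (L' q l * L p j + γ • (L' q j * L p l)) := by
        simp only [hL _ j _ l]
    _ = _ := by
        simp only [mul_add, Finset.sum_add_distrib, Finset.smul_sum, mul_smul_comm]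

theorem Exchange.map {n : ℕ} {A B : Type*} [Ring A] [Algebra ℂ A] [Ring B] [Algebra ℂ B] {γ : ℂ}
    {M M' : Matrix (Fin n) (Fin n) A} (h : Exchange γ M M') (φ : A →ₐ[ℂ] B) :
    Exchange γ (M.map φ) (M'.map φ) := fun i j k l => by
  simpa using congrArg φ (h i j k l)

/-! ### Scalar identities -/

theorem g_antisymm (c x y : ℂ) : g c y x = -g c x y := by
  unfold g
  rw [← neg_sub x y, div_neg]

/-- The scalar content of the Yang–Baxter equation. Every cancellation of unwanted contributions
below reduces to it. -/
theorem g_mul_g {c x y z : ℂ} (hxy : x ≠ y) (hxz : x ≠ z) (hyz : y ≠ z) :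
    g c x z * g c y z = g c x y * (g c y z - g c x z) := by
  unfold g
  have := sub_ne_zero.2 hxy
  have := sub_ne_zero.2 hxz
  have := sub_ne_zero.2 hyz
  field_simp
  ring

/-- The two values add up to `2`. Since `f` may vanish, exchange rules are kept multiplied by `f`,
and this allows a division in one of the two orders. -/
theorem f_ne_zero_or (c x y : ℂ) : f c x y ≠ 0 ∨ f c y x ≠ 0 := by
  by_contra! h
  have h1 := h.1
  have h2 := h.2
  unfold f at h1 h2
  rw [g_antisymm c x y] at h2
  have : (2 : ℂ) = 0 := by linear_combination h1 + h2
  norm_num at this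

/-! ### Splitting off the first factor of the auxiliary space -/

section Aux

variable {H : Type*} [AddCommGroup H] [Module ℂ H] {a : ℕ}

/-- The component along `e_β` in the first factor. -/
def slice (β : Fin 2) : AuxSpace H (a + 1) →ₗ[ℂ] AuxSpace H a :=
  LinearMap.funLeft ℂ H fun s => Fin.cons β s

theorem slice_apply (β : Fin 2) (x : AuxSpace H (a + 1)) (s : Fin a → Fin 2) :
    slice β x s = x (Fin.cons β s) := rfl

theorem slice_ext {x y : AuxSpace H (a + 1)} (h : ∀ β, slice β x = slice β y) : x = y := by
  funext s
  have := congrFun (h (s 0)) (Fin.tail s)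
  simpa [slice_apply] using this

/-- The vector with given components along the first factor. -/
def unslice (y : Fin 2 → AuxSpace H a) : AuxSpace H (a + 1) := fun s => y (s 0) (Fin.tail s)

@[simp] theorem slice_unslice (y : Fin 2 → AuxSpace H a) (β : Fin 2) :
    slice β (unslice y) = y β := by
  funext s
  simp [slice_apply, unslice]

/-- Operators on the last `a` factors, acting on `a + 1` factors. -/
def liftTail : Module.End ℂ (AuxSpace H a) →ₐ[ℂ] Module.End ℂ (AuxSpace H (a + 1)) :=
  AlgHom.ofLinearMap
    { toFun := fun X =>
        { toFun := fun x => unslice fun β => X (slice β x)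
          map_add' := fun x y => slice_ext fun β => by simp
          map_smul' := fun r x => slice_ext fun β => by simp }
      map_add' := fun X Y => LinearMap.ext fun x => slice_ext fun β => by simp
      map_smul' := fun r X => LinearMap.ext fun x => slice_ext fun β => by simp }
    (LinearMap.ext fun x => slice_ext fun β => by simp)
    (fun X Y => LinearMap.ext fun x => slice_ext fun β => by simp)

@[simp] theorem slice_liftTail (X : Module.End ℂ (AuxSpace H a)) (x : AuxSpace H (a + 1))
    (β : Fin 2) : slice β (liftTail X x) = X (slice β x) :=
  slice_unslice (fun β => X (slice β x)) β

theorem slice_siteE_zero (α β γ : Fin 2) (x : AuxSpace H (a + 1)) :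
    slice γ (siteE 0 α β x) = if γ = α then slice β x else 0 := by
  funext s
  by_cases h : γ = α <;> simp [slice_apply, siteE, h]

theorem liftTail_siteE (k : Fin a) (α β : Fin 2) :
    liftTail (siteE (H := H) k α β) = siteE k.succ α β := by
  refine LinearMap.ext fun x => slice_ext fun γ => ?_
  rw [slice_liftTail]
  funext s
  simp [slice_apply, siteE, Fin.cons_update]

theorem liftTail_compLeft (X : Module.End ℂ H) :
    liftTail (X.compLeft (Fin a → Fin 2)) = X.compLeft (Fin (a + 1) → Fin 2) := by
  refine LinearMap.ext fun x => slice_ext fun γ => ?_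
  rw [slice_liftTail]
  rfl

/-- The matrix `p + q 𝐩₀₁` with entries acting in the first factor. -/
def siteL (p q : ℂ) : Matrix (Fin 2) (Fin 2) (Module.End ℂ (AuxSpace H (a + 1))) :=
  Matrix.of fun α β => (if α = β then p else 0) • 1 + q • siteE 0 β α

theorem siteR_zero (c z w : ℂ) : siteR (H := H) (a := a + 1) c 0 z w = siteL 1 (g c z w) := by
  ext1 α β
  by_cases h : α = β <;> simp [siteR, siteL, h]

theorem siteR_succ (c : ℂ) (k : Fin a) (z w : ℂ) :
    siteR (H := H) c k.succ z w = (siteR c k z w).map liftTail := by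
  ext1 α β
  by_cases h : α = β <;> simp [siteR, h, liftTail_siteE]

theorem slice_siteL (p q : ℂ) (α β γ : Fin 2) (x : AuxSpace H (a + 1)) :
    slice γ (siteL p q α β x) = (if α = β then p • slice γ x else 0)
      + if γ = β then q • slice α x else 0 := by
  by_cases h : α = β <;> by_cases h' : γ = β <;>
    simp [siteL, h, h', slice_siteE_zero]

theorem commute_liftTail_siteL (X : Module.End ℂ (AuxSpace H a)) (p q : ℂ) (α β : Fin 2) :
    Commute (liftTail X) (siteL p q α β) := by
  refine LinearMap.ext fun x => slice_ext fun γ => ?_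
  simp only [Module.End.mul_apply, slice_liftTail, slice_siteL]
  split_ifs <;> simp

/-- Coefficients `p`, `q` are left free so that both `r = 1 + g 𝐩` and its residue `𝐩` (`p = 0`, `q
= 1`) are covered. For two `r`'s the hypothesis is `g_mul_g`. -/
theorem exchange_siteL {γ p q p' q' : ℂ} (h : q * q' = γ * (p * q' - p' * q)) :
    Exchange γ (siteL (H := H) (a := a) p q) (siteL p' q') := by
  intro i j k l
  refine LinearMap.ext fun x => slice_ext fun β => ?_
  simp only [LinearMap.add_apply, LinearMap.smul_apply, Module.End.mul_apply, map_add, map_smul,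
    slice_siteL]
  fin_cases i <;> fin_cases j <;> fin_cases k <;> fin_cases l <;> fin_cases β <;>
    simp <;> match_scalars <;>
    first | ring1 | linear_combination h | linear_combination -h

/-- The monodromy matrix `N` with the additional factor `p + q 𝐩₀₁` on the right. -/
def extendRight (N : Matrix (Fin 2) (Fin 2) (Module.End ℂ (AuxSpace H a))) (p q : ℂ) :
    Matrix (Fin 2) (Fin 2) (Module.End ℂ (AuxSpace H (a + 1))) :=
  N.map liftTail * siteL p q

theorem slice_extendRight (N : Matrix (Fin 2) (Fin 2) (Module.End ℂ (AuxSpace H a))) (p q : ℂ)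
    (α β γ : Fin 2) (x : AuxSpace H (a + 1)) :
    slice γ (extendRight N p q α β x) = p • N α β (slice γ x)
      + if γ = β then q • ∑ ε, N α ε (slice ε x) else 0 := by
  simp only [extendRight, Matrix.mul_apply, Matrix.map_apply, LinearMap.sum_apply, map_sum,
    Module.End.mul_apply, slice_liftTail, slice_siteL, map_add, Finset.sum_add_distrib]
  congr 1
  · simp [apply_ite]
  · split_ifs <;> simp

theorem Exchange.extendRight {γ p q p' q' : ℂ}
    {N N' : Matrix (Fin 2) (Fin 2) (Module.End ℂ (AuxSpace H a))} (hN : Exchange γ N N')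
    (h : q * q' = γ * (p * q' - p' * q)) :
    Exchange γ (extendRight N p q) (extendRight N' p' q') :=
  (hN.map liftTail).mul (exchange_siteL h) (fun _ _ _ _ => commute_liftTail_siteL _ _ _ _ _)
    fun _ _ _ _ => commute_liftTail_siteL _ _ _ _ _

/-- Since `r_{01}` is the rightmost factor, removing the first site leaves a nested monodromy matrix
for the remaining variables. This recursion drives the inductions on `a`. -/
theorem nestedT_succ (c : ℂ) (T : ℂ → Matrix (Fin 3) (Fin 3) (Module.End ℂ H))
    (u : Fin (a + 1) → ℂ) (z : ℂ) :
    nestedT c T u z = extendRight (nestedT c T (Fin.tail u) z) 1 (g c z (u 0)) := by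
  have hm : ∀ l : List (Matrix (Fin 2) (Fin 2) (Module.End ℂ (AuxSpace H a))),
      l.prod.map liftTail = (l.map fun M => M.map (liftTail (H := H))).prod := fun l =>
    map_list_prod (liftTail (H := H) (a := a)).mapMatrix l
  have hmul : ∀ M N : Matrix (Fin 2) (Fin 2) (Module.End ℂ (AuxSpace H a)),
      (M * N).map liftTail = M.map liftTail * N.map liftTail := fun M N =>
    map_mul (liftTail (H := H) (a := a)).mapMatrix M N
  rw [extendRight, nestedT, nestedT, hmul, hm, List.map_reverse, List.map_ofFn, List.ofFn_succ,
    List.reverse_cons, List.prod_append, List.prod_singleton, siteR_zero, mul_assoc]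
  congr 1
  · ext1 α β
    simp [liftTail_compLeft]
  · congr 4
    funext k
    exact siteR_succ _ _ _ _

theorem nestedT_zero (c : ℂ) (T : ℂ → Matrix (Fin 3) (Fin 3) (Module.End ℂ H))
    (u : Fin 0 → ℂ) (z : ℂ) (α β : Fin 2) (x : AuxSpace H 0) (s : Fin 0 → Fin 2) :
    nestedT c T u z α β x s = blockD T z α β (x s) := by
  simp [nestedT]

end Aux

section Families

variable {H : Type*} [AddCommGroup H] [Module ℂ H] {a : ℕ}

/-! ### The row `𝔹₁(w_1) ⋯ 𝔹_a(w_a)` as a linear map -/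

/-- `rowApply` as a linear map. -/
def row (T : ℂ → Matrix (Fin 3) (Fin 3) (Module.End ℂ H)) (w : Fin a → ℂ) :
    AuxSpace H a →ₗ[ℂ] H :=
  ∑ β : Fin a → Fin 2, (List.ofFn fun k => blockB T (w k) (β k)).prod ∘ₗ LinearMap.proj β

theorem rowApply_eq_row (T : ℂ → Matrix (Fin 3) (Fin 3) (Module.End ℂ H)) (w : Fin a → ℂ)
    (x : AuxSpace H a) : rowApply T w x = row T w x := by
  simp [rowApply, row]

theorem row_zero (T : ℂ → Matrix (Fin 3) (Fin 3) (Module.End ℂ H)) (w : Fin 0 → ℂ)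
    (x : AuxSpace H 0) : row T w x = x 0 := by
  simp [row]
  congr 1

theorem row_succ (T : ℂ → Matrix (Fin 3) (Fin 3) (Module.End ℂ H)) (w : Fin (a + 1) → ℂ)
    (x : AuxSpace H (a + 1)) :
    row T w x = ∑ β, blockB T (w 0) β (row T (Fin.tail w) (slice β x)) := by
  simp only [row, LinearMap.sum_apply]
  rw [← (Fin.consEquiv fun _ => Fin 2).sum_comp, Fintype.sum_prod_type]
  refine Finset.sum_congr rfl fun β _ => ?_
  rw [map_sum]
  refine Finset.sum_congr rfl fun s _ => ?_
  simp [List.ofFn_succ, Fin.consEquiv, slice_apply, Fin.tail]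

/-- The operator `P_{ij} + γ` on the auxiliary factors. -/
def twist (γ : ℂ) (i j : Fin a) : Module.End ℂ (AuxSpace H a) :=
  LinearMap.funLeft ℂ H (fun s : Fin a → Fin 2 => s ∘ Equiv.swap i j) + γ • 1

theorem twist_apply (γ : ℂ) (i j : Fin a) (x : AuxSpace H a) (s : Fin a → Fin 2) :
    twist γ i j x s = x (s ∘ Equiv.swap i j) + γ • x s := rfl

theorem swap_succ_apply (i j k : Fin a) :
    Equiv.swap i.succ j.succ k.succ = (Equiv.swap i j k).succ :=
  (Fin.succ_injective a).swap_apply i j k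

theorem cons_comp_swap_succ {α : Type*} (i j : Fin a) (p : α) (s : Fin a → α) :
    (Fin.cons p s : Fin (a + 1) → α) ∘ Equiv.swap i.succ j.succ
      = Fin.cons p (s ∘ Equiv.swap i j) := by
  funext k
  refine Fin.cases ?_ (fun k => ?_) k
  · simp [Equiv.swap_apply_of_ne_of_ne (Fin.succ_ne_zero i).symm (Fin.succ_ne_zero j).symm]
  · simp [swap_succ_apply]

theorem cons_cons_comp_swap {α : Type*} (p q : α) (s : Fin a → α) :
    (Fin.cons p (Fin.cons q s : Fin (a + 1) → α) : Fin (a + 2) → α) ∘ Equiv.swap 0 1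
      = Fin.cons q (Fin.cons p s : Fin (a + 1) → α) := by
  funext k
  refine Fin.cases ?_ (fun k => Fin.cases ?_ (fun k => ?_) k) k
  · simp
  · simp
  · rw [Function.comp_apply, Equiv.swap_apply_of_ne_of_ne (Fin.succ_ne_zero _)]
    · simp
    · intro h
      exact Fin.succ_ne_zero k (Fin.succ_injective _ h)

theorem slice_twist_succ (γ : ℂ) (i j : Fin a) (β : Fin 2) (x : AuxSpace H (a + 1)) :
    slice β (twist γ i.succ j.succ x) = twist γ i j (slice β x) := by
  funext s
  simp [slice_apply, twist_apply, cons_comp_swap_succ]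

theorem slice_slice_twist (γ : ℂ) (β δ : Fin 2) (x : AuxSpace H (a + 2)) :
    slice δ (slice β (twist γ 0 1 x)) = slice β (slice δ x) + γ • slice δ (slice β x) := by
  funext s
  simp [slice_apply, twist_apply, cons_cons_comp_swap]

theorem slice_compLeft (X : Module.End ℂ H) (β : Fin 2) (x : AuxSpace H (a + 1)) :
    slice β (X.compLeft (Fin (a + 1) → Fin 2) x) = X.compLeft (Fin a → Fin 2) (slice β x) := rfl

/-- Adjacent indices are `0, 1` or successors of adjacent indices. -/
theorem adjacent_cases {motive : ∀ (a : ℕ) (_ _ : Fin a), Prop}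
    (zero : ∀ a, motive (a + 2) 0 1)
    (succ : ∀ a (i j : Fin a), motive a i j → motive (a + 1) i.succ j.succ) :
    ∀ (a : ℕ) (i j : Fin a), (j : ℕ) = i + 1 → motive a i j := by
  intro a
  induction a with
  | zero => exact fun i => i.elim0
  | succ a ih =>
    intro i j
    refine Fin.cases ?_ (fun i => ?_) i <;> refine Fin.cases ?_ (fun j => ?_) j
    · simp
    · intro h
      cases a with
      | zero => exact j.elim0
      | succ a =>
        obtain rfl : j = 0 := by
          ext
          simpa using h
        exact zero a
    · simp
    · intro h
      exact succ a i j (ih i j (by simpa using h))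

theorem blockB_mul_blockB {c : ℂ} {S : Set ℂ}
    {T : ℂ → Matrix (Fin 3) (Fin 3) (Module.End ℂ H)} (hT : RTT c S T) {p q : ℂ} (hp : p ∈ S)
    (hq : q ∈ S) (hpq : p ≠ q) (β δ : Fin 2) (x : H) :
    f c p q • blockB T p β (blockB T q δ x) =
      blockB T q δ (blockB T p β x) + g c p q • blockB T q β (blockB T p δ x) := by
  have h := LinearMap.congr_fun (hT.exchange hp hq hpq 0 β.succ 0 δ.succ) x
  simp only [LinearMap.add_apply, LinearMap.smul_apply, Module.End.mul_apply] at h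
  rw [f, add_smul, one_smul]
  exact h

/-- The exchange relation of two adjacent `𝔹`'s, with its `R`-matrix moved onto the vector. -/
theorem row_twist {c : ℂ} {S : Set ℂ} {T : ℂ → Matrix (Fin 3) (Fin 3) (Module.End ℂ H)}
    (hT : RTT c S T) (i j : Fin a) (hij : (j : ℕ) = i + 1) (w : Fin a → ℂ) (hw : ∀ k, w k ∈ S)
    (hne : w i ≠ w j) (x : AuxSpace H a) :
    f c (w i) (w j) • row T w x =
      row T (w ∘ Equiv.swap i j) (twist (g c (w i) (w j)) i j x) := by
  refine adjacent_cases (motive := fun a i j => ∀ (w : Fin a → ℂ), (∀ k, w k ∈ S) → w i ≠ w j →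
    ∀ x : AuxSpace H a, f c (w i) (w j) • row T w x =
      row T (w ∘ Equiv.swap i j) (twist (g c (w i) (w j)) i j x)) ?_ ?_ a i j hij w hw hne x
  · intro a w hw hne x
    have ht : Fin.tail (Fin.tail (w ∘ Equiv.swap 0 1)) = Fin.tail (Fin.tail w) := by
      funext k
      have : (k.succ.succ : Fin (a + 2)) ≠ 1 := fun h =>
        Fin.succ_ne_zero k (Fin.succ_injective _ h)
      simp [Fin.tail, Equiv.swap_apply_of_ne_of_ne (Fin.succ_ne_zero _) this]
    have h := fun (β δ : Fin 2) y => blockB_mul_blockB hT (hw 0) (hw 1) hne β δ y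
    have h1 : Fin.tail w 0 = w 1 := rfl
    have h2 : Fin.tail (w ∘ Equiv.swap 0 1) 0 = w 0 := by simp [Fin.tail]
    have h3 : (w ∘ Equiv.swap 0 1) 0 = w 1 := by simp
    simp only [row_succ, ht, h1, h2, h3, slice_slice_twist, map_sum, Finset.smul_sum, h, map_add,
      map_smul, Finset.sum_add_distrib]
    rw [Finset.sum_comm]
  · intro a i j ih w hw hne x
    have h0 : (w ∘ Equiv.swap i.succ j.succ) 0 = w 0 := by
      simp [Equiv.swap_apply_of_ne_of_ne (Fin.succ_ne_zero i).symm (Fin.succ_ne_zero j).symm]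
    have ht : Fin.tail (w ∘ Equiv.swap i.succ j.succ) = Fin.tail w ∘ Equiv.swap i j := by
      funext k
      simp [Fin.tail, swap_succ_apply]
    simp only [row_succ, slice_twist_succ, h0, ht, Finset.smul_sum]
    refine Finset.sum_congr rfl fun β _ => ?_
    rw [← map_smul]
    exact congrArg _ (ih (Fin.tail w) (fun k => hw _) hne _)

/-! ### Covariance of the nested Bethe vector under permutations of `ū` -/

/-- The Yang–Baxter equation on the auxiliary space and the first two sites; `N` does not act on
these sites. -/
theorem twist_extendRight {γ p q : ℂ} (h : p * q = γ * (p - q))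
    (N : Matrix (Fin 2) (Fin 2) (Module.End ℂ (AuxSpace H a))) (α β : Fin 2)
    (x : AuxSpace H (a + 2)) :
    twist γ 0 1 (extendRight (extendRight N 1 q) 1 p α β x) =
      extendRight (extendRight N 1 p) 1 q α β (twist γ 0 1 x) := by
  refine slice_ext fun δ => slice_ext fun δ' => ?_
  simp only [slice_slice_twist, slice_extendRight, map_add, map_smul, apply_ite (slice _),
    map_zero, one_smul, Fin.sum_univ_two]
  fin_cases β <;> fin_cases δ <;> fin_cases δ' <;> simp <;> match_scalars <;>
    first | ring1 | linear_combination h | linear_combination -h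

theorem twist_nestedT (c : ℂ) (T : ℂ → Matrix (Fin 3) (Fin 3) (Module.End ℂ H)) (i j : Fin a)
    (hij : (j : ℕ) = i + 1) (u : Fin a → ℂ) (z : ℂ) (hne : u i ≠ u j) (hi : z ≠ u i)
    (hj : z ≠ u j) (α β : Fin 2) (x : AuxSpace H a) :
    twist (g c (u i) (u j)) i j (nestedT c T u z α β x) =
      nestedT c T (u ∘ Equiv.swap i j) z α β (twist (g c (u i) (u j)) i j x) := by
  refine adjacent_cases (motive := fun a i j => ∀ (u : Fin a → ℂ), u i ≠ u j → z ≠ u i → z ≠ u j →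
    ∀ (α β : Fin 2) (x : AuxSpace H a), twist (g c (u i) (u j)) i j (nestedT c T u z α β x) =
      nestedT c T (u ∘ Equiv.swap i j) z α β (twist (g c (u i) (u j)) i j x))
    ?_ ?_ a i j hij u hne hi hj α β x
  · intro a u hne hi hj α β x
    have ht : Fin.tail (Fin.tail (u ∘ Equiv.swap 0 1)) = Fin.tail (Fin.tail u) := by
      funext k
      have : (k.succ.succ : Fin (a + 2)) ≠ 1 := fun h =>
        Fin.succ_ne_zero k (Fin.succ_injective _ h)
      simp [Fin.tail, Equiv.swap_apply_of_ne_of_ne (Fin.succ_ne_zero _) this]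
    have h1 : Fin.tail u 0 = u 1 := rfl
    have h2 : Fin.tail (u ∘ Equiv.swap 0 1) 0 = u 0 := by simp [Fin.tail]
    have h3 : (u ∘ Equiv.swap 0 1) 0 = u 1 := by simp
    rw [nestedT_succ, nestedT_succ, nestedT_succ c T (u ∘ _), nestedT_succ c T (Fin.tail (u ∘ _)),
      ht, h1, h2, h3]
    refine twist_extendRight ?_ _ _ _ _
    have := g_mul_g (c := c) hne hi.symm hj.symm
    rw [g_antisymm c (u 0) z, g_antisymm c (u 1) z]
    linear_combination this
  · intro a i j ih u hne hi hj α β x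
    have h0 : (u ∘ Equiv.swap i.succ j.succ) 0 = u 0 := by
      simp [Equiv.swap_apply_of_ne_of_ne (Fin.succ_ne_zero i).symm (Fin.succ_ne_zero j).symm]
    have ht : Fin.tail (u ∘ Equiv.swap i.succ j.succ) = Fin.tail u ∘ Equiv.swap i j := by
      funext k
      simp [Fin.tail, swap_succ_apply]
    have ih' := ih (Fin.tail u) hne hi hj
    simp only [Fin.tail] at ih'
    refine slice_ext fun δ => ?_
    rw [nestedT_succ, nestedT_succ, h0, ht]
    simp only [slice_twist_succ, slice_extendRight, map_add, one_smul]
    rw [ih']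
    congr 1
    split_ifs
    · simp only [map_smul, map_sum, ih']
    · simp

/-- Families of vectors on which `P_{ij} + g(u_i,u_j)`, for adjacent `i, j`, amounts to exchanging
`u_i` and `u_j`, up to the factor `f(u_i,u_j)`. -/
def Covariant (c : ℂ) (A : Set ℂ) (F : (Fin a → ℂ) → AuxSpace H a) : Prop :=
  ∀ u, Function.Injective u → (∀ k, u k ∈ A) → ∀ i j : Fin a, (j : ℕ) = i + 1 →
    twist (g c (u i) (u j)) i j (F u) = f c (u i) (u j) • F (u ∘ Equiv.swap i j)

theorem cons_injective_of_mem {A : Set ℂ} {p : ℂ} {u : Fin a → ℂ} (hu : Function.Injective u)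
    (hA : ∀ k, u k ∈ A \ {p}) : Function.Injective (Fin.cons p u : Fin (a + 1) → ℂ) :=
  Fin.cons_injective_iff.2 ⟨fun ⟨k, hk⟩ => (hA k).2 hk, hu⟩

theorem cons_mem {A : Set ℂ} {p : ℂ} (hp : p ∈ A) {u : Fin a → ℂ} (hA : ∀ k, u k ∈ A)
    (k : Fin (a + 1)) : (Fin.cons p u : Fin (a + 1) → ℂ) k ∈ A := by
  refine Fin.cases ?_ (fun k => ?_) k
  · exact hp
  · exact hA k

/-- Freezing the first variable keeps covariance in the others, so inductions on `a` can run over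
families. The point `p` leaves the domain to keep the variables distinct. -/
theorem Covariant.slice {c : ℂ} {A : Set ℂ} {F : (Fin (a + 1) → ℂ) → AuxSpace H (a + 1)}
    (hF : Covariant c A F) {p : ℂ} (hp : p ∈ A) (β : Fin 2) :
    Covariant c (A \ {p}) fun u => slice β (F (Fin.cons p u)) := by
  intro u hu hA i j hij
  have h := hF (Fin.cons p u) (cons_injective_of_mem hu hA) (cons_mem hp fun k => (hA k).1)
    i.succ j.succ (by simpa using hij)
  rw [cons_comp_swap_succ, Fin.cons_succ, Fin.cons_succ] at h
  rw [← slice_twist_succ, h, map_smul]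

theorem Covariant.slice_slice {c : ℂ} {A : Set ℂ} {F : (Fin (a + 2) → ℂ) → AuxSpace H (a + 2)}
    (hF : Covariant c A F) {p q : ℂ} {w : Fin a → ℂ}
    (hi : Function.Injective (Fin.cons p (Fin.cons q w : Fin (a + 1) → ℂ) : Fin (a + 2) → ℂ))
    (hA : ∀ k, (Fin.cons p (Fin.cons q w : Fin (a + 1) → ℂ) : Fin (a + 2) → ℂ) k ∈ A)
    (β δ : Fin 2) :
    NABA.slice β (NABA.slice δ (F (Fin.cons p (Fin.cons q w : Fin (a + 1) → ℂ))))
        + g c p q • NABA.slice δ (NABA.slice β (F (Fin.cons p (Fin.cons q w : Fin (a + 1) → ℂ)))) =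
      f c p q • NABA.slice δ (NABA.slice β (F (Fin.cons q (Fin.cons p w : Fin (a + 1) → ℂ)))) := by
  have h := congrArg (fun x => NABA.slice δ (NABA.slice β x)) (hF _ hi hA 0 1 (by simp))
  simp only [slice_slice_twist, cons_cons_comp_swap, map_smul] at h
  exact h

theorem twist_nestedVac (γ : ℂ) (i j : Fin a) (vac : H) :
    twist γ i j (nestedVac a vac) = (1 + γ) • nestedVac a vac := by
  funext s
  have : s ∘ Equiv.swap i j = 0 ↔ s = 0 := by
    constructor
    · intro h
      funext k
      simpa using congrFun h (Equiv.swap i j k)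
    · rintro rfl
      rfl
  by_cases h : s = 0 <;> simp [twist_apply, nestedVac, this, add_smul, h]

theorem nestedVector_succ {b : ℕ} (c : ℂ) (T : ℂ → Matrix (Fin 3) (Fin 3) (Module.End ℂ H))
    (vac : H) (u : Fin a → ℂ) (v : Fin (b + 1) → ℂ) :
    nestedVector c T vac u v = nestedB c T u (v 0) (nestedVector c T vac u (Fin.tail v)) := by
  simp [nestedVector, List.ofFn_succ, Fin.tail]

/-- `P` fixes the nested vacuum, so `P + g` acts on it as `1 + g = f`; each creation operator is
then intertwined by `twist_nestedT`. -/
theorem covariant_nestedVector {b : ℕ} (c : ℂ)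
    (T : ℂ → Matrix (Fin 3) (Fin 3) (Module.End ℂ H)) (vac : H) (v : Fin b → ℂ) :
    Covariant c (Set.range v)ᶜ fun u : Fin a → ℂ => nestedVector c T vac u v := by
  intro u hu hA i j hij
  have hne : u i ≠ u j := fun h => by
    have := congrArg Fin.val (hu h)
    omega
  induction b with
  | zero => exact twist_nestedVac _ i j vac
  | succ b ih =>
    have h0 : ∀ k, v 0 ≠ u k := fun k h => hA k ⟨0, h⟩
    have ih' := ih (Fin.tail v) fun k ⟨l, hl⟩ => hA k ⟨l.succ, hl⟩
    simp only [nestedVector_succ] at ih' ⊢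
    rw [nestedB, twist_nestedT c T i j hij u _ hne (h0 i) (h0 j), ih', map_smul]
    rfl

end Families

/-! ### Moving `T₁₁` and `𝔻` through the row of `𝔹`'s -/

section Actions

variable {H : Type*} [AddCommGroup H] [Module ℂ H] {a : ℕ}

theorem prod_erase_eq {a : ℕ} (k : Fin a) (φ : Fin a → ℂ) :
    ∏ i ∈ Finset.univ.erase k, φ i = ∏ i, if i = k then 1 else φ i := by
  rw [← Finset.mul_prod_erase Finset.univ _ (Finset.mem_univ k), if_pos rfl, one_mul]
  exact Finset.prod_congr rfl fun i hi => (if_neg (Finset.ne_of_mem_erase hi)).symm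

theorem prod_erase_zero (φ : Fin (a + 1) → ℂ) :
    ∏ i ∈ Finset.univ.erase 0, φ i = ∏ i : Fin a, φ i.succ := by
  simp [prod_erase_eq, Fin.prod_univ_succ]

theorem prod_erase_succ (k : Fin a) (φ : Fin (a + 1) → ℂ) :
    ∏ i ∈ Finset.univ.erase k.succ, φ i = φ 0 * ∏ i ∈ Finset.univ.erase k, φ i.succ := by
  simp [prod_erase_eq, Fin.prod_univ_succ, (Fin.succ_ne_zero k).symm]

/-- The tuple `(z, u_1, …, u_{k-1}, u_{k+1}, …)`. -/
def frontSubst : {a : ℕ} → ℂ → (Fin a → ℂ) → Fin a → Fin a → ℂ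
  | 0, _, u, _ => u
  | _ + 1, z, u, k => Fin.cons z (k.removeNth u)

theorem frontSubst_zero (z : ℂ) (u : Fin (a + 1) → ℂ) :
    frontSubst z u 0 = Fin.cons z (Fin.tail u) := by
  simp only [frontSubst]
  rfl

theorem frontSubst_succ (z : ℂ) (u : Fin (a + 2) → ℂ) (k : Fin (a + 1)) :
    frontSubst z u k.succ = Fin.cons z (Fin.cons (u 0) (k.removeNth (Fin.tail u))) := by
  simp only [frontSubst]
  congr 1
  funext i
  refine Fin.cases ?_ (fun i => ?_) i <;> simp [Fin.removeNth, Fin.tail]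

/-- The commutation rule of `T₁₁` with `T₁₂`, `T₁₃`. -/
theorem T00_blockB {c : ℂ} {S : Set ℂ} {T : ℂ → Matrix (Fin 3) (Fin 3) (Module.End ℂ H)}
    (hT : RTT c S T) {z p : ℂ} (hz : z ∈ S) (hp : p ∈ S) (hzp : z ≠ p) (β : Fin 2) (x : H) :
    T z 0 0 (blockB T p β x) =
      f c p z • blockB T p β (T z 0 0 x) + g c z p • blockB T z β (T p 0 0 x) := by
  have h := LinearMap.congr_fun (hT.exchange hp hz hzp.symm 0 β.succ 0 0) x
  simp only [LinearMap.add_apply, LinearMap.smul_apply, Module.End.mul_apply] at h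
  rw [f, add_smul, one_smul, g_antisymm c p z]
  simp only [blockB]
  linear_combination (norm := module) (-1 : ℂ) • h

/-- The commutation rule of `𝔻` with `𝔹`. -/
theorem blockD_blockB {c : ℂ} {S : Set ℂ} {T : ℂ → Matrix (Fin 3) (Fin 3) (Module.End ℂ H)}
    (hT : RTT c S T) {z p : ℂ} (hz : z ∈ S) (hp : p ∈ S) (hzp : z ≠ p) (α γ β : Fin 2) (x : H) :
    blockD T z α γ (blockB T p β x) = blockB T p β (blockD T z α γ x)
      + g c z p • blockB T p γ (blockD T z α β x)
      - g c z p • blockB T z γ (blockD T p α β x) := by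
  have h := LinearMap.congr_fun (hT.exchange hz hp hzp α.succ γ.succ 0 β.succ) x
  simp only [LinearMap.add_apply, LinearMap.smul_apply, Module.End.mul_apply] at h
  simp only [blockB, blockD, Matrix.submatrix_apply]
  linear_combination (norm := module) (1 : ℂ) • h

theorem forall_mem_frontSubst {A : Set ℂ} {z : ℂ} (hz : z ∈ A) {u : Fin a → ℂ}
    (hu : ∀ k, u k ∈ A) (k i : Fin a) : frontSubst z u k i ∈ A := by
  cases a with
  | zero => exact k.elim0
  | succ a => exact cons_mem hz (fun i => hu _) i

theorem cons_cons_removeNth_injective {u : Fin (a + 2) → ℂ} (hu : Function.Injective u)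
    (k : Fin (a + 1)) : Function.Injective
      (Fin.cons (u 0) (Fin.cons (u k.succ) (k.removeNth (Fin.tail u)) : Fin (a + 1) → ℂ) :
        Fin (a + 2) → ℂ) := by
  rw [Fin.cons_injective_iff, Fin.cons_injective_iff]
  refine ⟨?_, ?_, ?_⟩
  · rintro ⟨i, hi⟩
    revert hi
    refine Fin.cases ?_ (fun i => ?_) i
    · intro h
      exact Fin.succ_ne_zero k (hu h)
    · intro h
      exact Fin.succ_ne_zero _ (hu h)
  · rintro ⟨i, hi⟩
    exact Fin.succAbove_ne k i (Fin.succ_injective _ (hu hi))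
  · intro i j h
    exact Fin.succAbove_right_injective (Fin.succ_injective _ (hu h))

/-- Induction on `a`, splitting off the first factor `𝔹(p)`. The induction hypothesis is needed both
at `z` and at `p`, because the two arguments may be exchanged. -/
theorem T00_row {c : ℂ} {S : Set ℂ} {T : ℂ → Matrix (Fin 3) (Fin 3) (Module.End ℂ H)}
    (hT : RTT c S T) (F : (Fin a → ℂ) → AuxSpace H a) (A : Set ℂ) (hAS : A ⊆ S)
    (hF : Covariant c A F) (u : Fin a → ℂ) (hu : Function.Injective u) (huA : ∀ k, u k ∈ A)
    (z : ℂ) (hz : z ∈ S) (hzu : ∀ k, z ≠ u k) :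
    T z 0 0 (row T u (F u)) =
      (∏ i, f c (u i) z) • row T u ((T z 0 0).compLeft _ (F u)) +
      ∑ k, (g c z (u k) * ∏ i ∈ Finset.univ.erase k, f c (u i) (u k)) •
        row T (frontSubst z u k) ((T (u k) 0 0).compLeft _ (F (frontSubst (u k) u k))) := by
  induction a generalizing A z with
  | zero => simp [row_zero]
  | succ a ih =>
    obtain ⟨p, u, rfl⟩ : ∃ p u', u = Fin.cons p u' := ⟨u 0, Fin.tail u, (Fin.cons_self_tail u).symm⟩
    have hp : p ∈ A := huA 0
    obtain ⟨hpu, hu'⟩ := Fin.cons_injective_iff.1 hu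
    have hpu : ∀ k, p ≠ u k := fun k h => hpu ⟨k, h.symm⟩
    have huA' : ∀ k, u k ∈ A := fun k => huA k.succ
    have hzp : z ≠ p := hzu 0
    have hzu' : ∀ k, z ≠ u k := fun k => hzu k.succ
    have ih' := fun (β : Fin 2) z hz hzu => ih (fun w => slice β (F (Fin.cons p w))) (A \ {p})
      (Set.sdiff_subset.trans hAS) (hF.slice hp β) u hu'
      (fun k => ⟨huA' k, fun h => hpu k h.symm⟩) z hz hzu
    -- The unwanted term at `u_k` arises in two ways: `z` passes `p` and is exchanged with `u_k`, or
    -- `z` is exchanged with `p`, which is then exchanged with `u_k`.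
    have key : ∀ k : Fin a,
        (∑ β, (f c p z * (g c z (u k) * ∏ i ∈ Finset.univ.erase k, f c (u i) (u k))) •
          blockB T p β (row T (frontSubst z u k) ((T (u k) 0 0).compLeft _
            (slice β (F (Fin.cons p (frontSubst (u k) u k)))))))
        + (∑ β, (g c z p * (g c p (u k) * ∏ i ∈ Finset.univ.erase k, f c (u i) (u k))) •
          blockB T z β (row T (frontSubst p u k) ((T (u k) 0 0).compLeft _
            (slice β (F (Fin.cons p (frontSubst (u k) u k)))))))
        = (g c z (u k) * (f c p (u k) * ∏ i ∈ Finset.univ.erase k, f c (u i) (u k))) •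
          row T (frontSubst z (Fin.cons p u) k.succ) ((T (u k) 0 0).compLeft _
            (F (frontSubst (u k) (Fin.cons p u) k.succ))) := by
      intro k
      cases a with
      | zero => exact k.elim0
      | succ a =>
        set P := ∏ i ∈ Finset.univ.erase k, f c (u i) (u k)
        rw [frontSubst_succ, frontSubst_succ]
        simp only [Fin.tail_cons, Fin.cons_zero, frontSubst]
        set w := k.removeNth u
        have hinj : Function.Injective (Fin.cons p (Fin.cons (u k) w : Fin (a + 1) → ℂ)) :=
          cons_cons_removeNth_injective hu k
        have hmem := cons_mem hp (cons_mem (huA' k) fun i => huA' (k.succAbove i))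
        have hex : ∀ x : AuxSpace H (a + 2), f c p z • row T (Fin.cons p (Fin.cons z w)) x
            = row T (Fin.cons z (Fin.cons p w)) (twist (g c p z) 0 1 x) := by
          intro x
          have := row_twist hT 0 1 (by simp) (Fin.cons p (Fin.cons z w : Fin (a + 1) → ℂ))
            (cons_mem (hAS hp) (cons_mem hz fun i => hAS (huA' (k.succAbove i)))) hzp.symm x
          rw [cons_cons_comp_swap] at this
          exact this
        have hcov := hF _ hinj hmem 0 1 (by simp)
        rw [cons_cons_comp_swap] at hcov
        change twist (g c p (u k)) 0 1 _ = f c p (u k) • _ at hcov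
        set x := F (Fin.cons p (Fin.cons (u k) w : Fin (a + 1) → ℂ))
        set y := F (Fin.cons (u k) (Fin.cons p w : Fin (a + 1) → ℂ))
        -- The cases `q = p` and `q = z` give the rows starting with `(p, z)` and `(z, p)`.
        have h1 : ∀ q, ∑ β, blockB T q β (row T (Fin.cons (if q = p then z else p) w)
            ((T (u k) 0 0).compLeft _ (slice β x))) = row T (Fin.cons q
              (Fin.cons (if q = p then z else p) w)) ((T (u k) 0 0).compLeft _ x) := by
          intro q
          rw [row_succ]
          rfl
        have h2 := h1 p
        have h3 := h1 z
        rw [if_pos rfl] at h2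
        rw [if_neg hzp] at h3
        rw [← Finset.smul_sum, ← Finset.smul_sum, h2, h3, mul_comm (f c p z), mul_smul, hex]
        have h4 : ∀ γ, twist γ 0 1 ((T (u k) 0 0).compLeft _ x)
            = (T (u k) 0 0).compLeft _ (twist γ 0 1 x) := by
          intro γ
          funext s
          simp [twist_apply]
        -- Row exchange produces `P + g(p,z)`, while covariance needs `P + g(p,u_k)`. The scalar
        -- difference cancels the second contribution by `g_mul_g`.
        have h5 : ∀ γ, twist γ 0 1 x = twist (g c p (u k)) 0 1 x + (γ - g c p (u k)) • x := by
          intro γ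
          funext s
          simp [twist_apply, sub_smul]
        rw [h4, h5, hcov, map_add, map_smul, map_smul, map_add, map_smul, map_smul]
        match_scalars
        · ring
        · have := g_mul_g (c := c) hzp (hzu' k) (hpu k)
          rw [g_antisymm c z p]
          linear_combination (-P) * this
    rw [row_succ, map_sum]
    simp only [Fin.cons_zero, Fin.tail_cons]
    simp only [T00_blockB hT hz (hAS hp) hzp, ih' _ z hz hzu', ih' _ p (hAS hp) hpu, map_add,
      map_smul, map_sum, smul_add, Finset.sum_add_distrib, Finset.smul_sum, smul_smul]
    rw [Fin.prod_univ_succ, Fin.sum_univ_succ (n := a), prod_erase_zero, frontSubst_zero, frontSubst_zero]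
    simp only [prod_erase_succ, Fin.cons_zero, Fin.cons_succ, ← key, Fin.tail_cons]
    rw [row_succ, row_succ]
    simp only [Fin.cons_zero, Fin.tail_cons, slice_compLeft, Finset.sum_add_distrib,
      Finset.smul_sum]
    rw [Finset.sum_comm (γ := Fin a), Finset.sum_comm (γ := Fin a)]
    abel

/-- The operator `𝔻(w_1) r(w_1,w_a) ⋯ r(w_1,w_2)` (row `α`), applied to a family `y` of vectors
and with the first index of the result labelling the family. -/
def residue (c : ℂ) (T : ℂ → Matrix (Fin 3) (Fin 3) (Module.End ℂ H)) (α : Fin 2) :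
    {a : ℕ} → (Fin a → ℂ) → (Fin 2 → AuxSpace H a) → AuxSpace H a
  | 0, _, _ => 0
  | _ + 1, w, y => unslice fun β => ∑ δ, nestedT c T (Fin.tail w) (w 0) α δ (slice δ (y β))

/-- Commuting `𝔻` past `𝔹` trades the column index of `𝔻` for the site index. The induction
therefore needs a family `F γ` contracted with that column index, rather than a single vector. -/
theorem blockD_row {c : ℂ} {S : Set ℂ} {T : ℂ → Matrix (Fin 3) (Fin 3) (Module.End ℂ H)}
    (hT : RTT c S T) (α : Fin 2) (F : Fin 2 → (Fin a → ℂ) → AuxSpace H a) (A : Set ℂ) (hAS : A ⊆ S)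
    (hF : ∀ γ, Covariant c A (F γ)) (u : Fin a → ℂ) (hu : Function.Injective u)
    (huA : ∀ k, u k ∈ A) (z : ℂ) (hz : z ∈ S) (hzu : ∀ k, z ≠ u k) :
    ∑ γ, blockD T z α γ (row T u (F γ u)) =
      row T u (∑ γ, nestedT c T u z α γ (F γ u)) +
      ∑ k, g c (u k) z • row T (frontSubst z u k)
        (residue c T α (frontSubst (u k) u k) fun γ => F γ (frontSubst (u k) u k)) := by
  induction a generalizing A z with
  | zero => simp [row_zero, nestedT_zero]
  | succ a ih =>
    obtain ⟨p, u, rfl⟩ : ∃ p u', u = Fin.cons p u' := ⟨u 0, Fin.tail u, (Fin.cons_self_tail u).symm⟩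
    have hp : p ∈ A := huA 0
    obtain ⟨hpu, hu'⟩ := Fin.cons_injective_iff.1 hu
    have hpu : ∀ k, p ≠ u k := fun k h => hpu ⟨k, h.symm⟩
    have huA' : ∀ k, u k ∈ A := fun k => huA k.succ
    have hzp : z ≠ p := hzu 0
    have hzu' : ∀ k, z ≠ u k := fun k => hzu k.succ
    have ih₁ := fun (β : Fin 2) => ih (fun γ w => slice β (F γ (Fin.cons p w))) (A \ {p})
      (Set.sdiff_subset.trans hAS) (fun γ => (hF γ).slice hp β) u hu'
      (fun k => ⟨huA' k, fun h => hpu k h.symm⟩) z hz hzu'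
    have ih₂ := fun (β : Fin 2) z hz hzu => ih (fun γ w => slice γ (F β (Fin.cons p w))) (A \ {p})
      (Set.sdiff_subset.trans hAS) (fun γ => (hF β).slice hp γ) u hu'
      (fun k => ⟨huA' k, fun h => hpu k h.symm⟩) z hz hzu
    -- Three contributions: past `𝔹(p)` unchanged, past it with indices exchanged, and with `z` and
    -- `p` exchanged. The first two combine to `P + g(z,p)` and are merged by row exchange.
    have key : ∀ k : Fin a,
        (∑ β, g c (u k) z • blockB T p β (row T (frontSubst z u k)
          (residue c T α (frontSubst (u k) u k) fun γ =>
            slice β (F γ (Fin.cons p (frontSubst (u k) u k))))))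
        + (∑ β, (g c z p * g c (u k) z) • blockB T p β (row T (frontSubst z u k)
          (residue c T α (frontSubst (u k) u k) fun γ =>
            slice γ (F β (Fin.cons p (frontSubst (u k) u k))))))
        - (∑ β, (g c z p * g c (u k) p) • blockB T z β (row T (frontSubst p u k)
          (residue c T α (frontSubst (u k) u k) fun γ =>
            slice γ (F β (Fin.cons p (frontSubst (u k) u k))))))
        = g c (u k) z • row T (frontSubst z (Fin.cons p u) k.succ)
          (residue c T α (frontSubst (u k) (Fin.cons p u) k.succ) fun γ =>
            F γ (frontSubst (u k) (Fin.cons p u) k.succ)) := by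
      intro k
      cases a with
      | zero => exact k.elim0
      | succ a =>
        rw [frontSubst_succ, frontSubst_succ]
        simp only [Fin.tail_cons, Fin.cons_zero, frontSubst]
        set w := k.removeNth u
        have hinj' : Function.Injective (Fin.cons p (Fin.cons (u k) w : Fin (a + 1) → ℂ)) :=
          cons_cons_removeNth_injective hu k
        have hinj : Function.Injective (Fin.cons (u k) (Fin.cons p w : Fin (a + 1) → ℂ)) := by
          rw [← cons_cons_comp_swap]
          exact hinj'.comp (Equiv.injective _)
        have hmem := cons_mem (huA' k) (cons_mem hp fun i => huA' (k.succAbove i))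
        have hex : ∀ x : AuxSpace H (a + 2), f c z p • row T (Fin.cons z (Fin.cons p w)) x
            = row T (Fin.cons p (Fin.cons z w)) (twist (g c z p) 0 1 x) := by
          intro x
          have := row_twist hT 0 1 (by simp) (Fin.cons z (Fin.cons p w : Fin (a + 1) → ℂ))
            (cons_mem hz (cons_mem (hAS hp) fun i => hAS (huA' (k.succAbove i)))) hzp x
          rw [cons_cons_comp_swap] at this
          exact this
        have hcov := fun β => (hF β).slice_slice hinj hmem
        set x := fun β => F β (Fin.cons p (Fin.cons (u k) w : Fin (a + 1) → ℂ))
        let N := nestedT c T w (u k)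
        -- All contributions are multiples of `y` or of its image under `P`, placed in a row. In
        -- `h₃` covariance absorbs the factor `r(u_k,p)` and leaves `f(u_k,p)`.
        let y : AuxSpace H (a + 2) := unslice fun β => unslice fun β' =>
          ∑ δ, N α δ (slice δ (slice β' (x β)))
        have h₁ : ∀ β, residue c T α (Fin.cons (u k) w : Fin (a + 1) → ℂ)
            (fun γ => slice γ (x β)) = slice β y := by
          intro β
          simp [residue, y, N]
        have h₂ : ∀ β, residue c T α (Fin.cons (u k) w : Fin (a + 1) → ℂ)
            (fun γ => slice β (x γ)) = slice β (twist (g c z p) 0 1 y) - g c z p • slice β y := by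
          intro β
          refine slice_ext fun δ => ?_
          simp [residue, y, N, slice_slice_twist]
        have h₃ : residue c T α (Fin.cons (u k) (Fin.cons p w : Fin (a + 1) → ℂ))
            (fun γ => F γ (Fin.cons (u k) (Fin.cons p w : Fin (a + 1) → ℂ)))
            = f c (u k) p • y := by
          refine slice_ext fun β => slice_ext fun β' => ?_
          have h := fun δ => hcov β β' δ
          simp only [residue, y, N, slice_unslice, map_smul, map_sum, Fin.tail_cons, Fin.cons_zero,
            nestedT_succ c T (Fin.cons p w), slice_extendRight, one_smul, Finset.sum_add_distrib,
            Finset.sum_ite_eq, Finset.mem_univ, if_true, Finset.smul_sum]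
          rw [← Finset.sum_add_distrib]
          refine Finset.sum_congr rfl fun δ _ => ?_
          simpa only [map_add, map_smul] using congrArg (nestedT c T w (u k) α δ) (h δ)
        have hrow : ∀ q r (x : AuxSpace H (a + 2)), ∑ β, blockB T q β (row T (Fin.cons r w)
            (slice β x)) = row T (Fin.cons q (Fin.cons r w)) x := by
          intro q r x
          rw [row_succ]
          rfl
        change (∑ β, _ • blockB T p β (row T _ (residue c T α (Fin.cons (u k) w : Fin (a + 1) → ℂ)
            (fun γ => slice β (x γ))))) + (∑ β, _ • blockB T p β (row T _
            (residue c T α (Fin.cons (u k) w : Fin (a + 1) → ℂ) (fun γ => slice γ (x β)))))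
            - (∑ β, _ • blockB T z β (row T _
            (residue c T α (Fin.cons (u k) w : Fin (a + 1) → ℂ) (fun γ => slice γ (x β))))) = _
        simp only [h₁, h₂, h₃, map_sub, map_smul, smul_sub, Finset.sum_sub_distrib]
        simp only [← Finset.smul_sum, hrow, ← hex]
        have := g_mul_g (c := c) hzp (hzu' k) (hpu k)
        rw [g_antisymm c z (u k), g_antisymm c p (u k), f, f, g_antisymm c p (u k)]
        match_scalars
        · linear_combination -this
        · ring
    rw [Fin.sum_univ_succ (n := a), frontSubst_zero, frontSubst_zero]
    simp only [Fin.cons_zero, Fin.cons_succ, ← key, Fin.tail_cons]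
    have hl : ∑ γ, blockD T z α γ (row T (Fin.cons p u) (F γ (Fin.cons p u))) =
        (∑ β, blockB T p β (∑ γ, blockD T z α γ (row T u (slice β (F γ (Fin.cons p u))))))
        + (∑ β, g c z p •
          blockB T p β (∑ γ, blockD T z α γ (row T u (slice γ (F β (Fin.cons p u))))))
        - ∑ β, g c z p •
          blockB T z β (∑ γ, blockD T p α γ (row T u (slice γ (F β (Fin.cons p u))))) := by
      simp only [row_succ, map_sum, Fin.cons_zero, Fin.tail_cons,
        blockD_blockB hT hz (hAS hp) hzp, Finset.sum_add_distrib, Finset.sum_sub_distrib,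
        Finset.smul_sum]
      congr 2
      exact Finset.sum_comm
    rw [hl]
    simp only [ih₁, ih₂ _ z hz hzu', ih₂ _ p (hAS hp) hpu]
    have hw : row T (Fin.cons p u) (∑ γ, nestedT c T (Fin.cons p u) z α γ (F γ (Fin.cons p u))) =
        (∑ β, blockB T p β (row T u (∑ γ, nestedT c T u z α γ (slice β (F γ (Fin.cons p u))))))
        + (∑ β, g c z p •
          blockB T p β (row T u (∑ γ, nestedT c T u z α γ (slice γ (F β (Fin.cons p u)))))) := by
      have hs : ∀ β, slice β (∑ γ, nestedT c T (Fin.cons p u) z α γ (F γ (Fin.cons p u))) =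
          (∑ γ, nestedT c T u z α γ (slice β (F γ (Fin.cons p u))))
            + g c z p • ∑ γ, nestedT c T u z α γ (slice γ (F β (Fin.cons p u))) := by
        intro β
        simp only [nestedT_succ c T (Fin.cons p u), map_sum, slice_extendRight, one_smul,
          Fin.tail_cons, Fin.cons_zero, Finset.sum_add_distrib, Finset.sum_ite_eq,
          Finset.mem_univ, if_true]
      simp only [row_succ, Fin.cons_zero, Fin.tail_cons, hs, map_add, map_smul,
        Finset.sum_add_distrib]
    have h0 : row T (Fin.cons z u) (residue c T α (Fin.cons p u) fun γ => F γ (Fin.cons p u)) =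
        ∑ β, blockB T z β (row T u (∑ γ, nestedT c T u p α γ (slice γ (F β (Fin.cons p u))))) := by
      simp only [row_succ, Fin.cons_zero, Fin.tail_cons, residue, slice_unslice]
    rw [hw, h0, g_antisymm c z p]
    simp only [map_add, map_sum, map_smul, smul_add, Finset.sum_add_distrib,
      Finset.sum_sub_distrib, Finset.smul_sum, smul_smul, neg_smul, Finset.sum_neg_distrib]
    rw [Finset.sum_comm (γ := Fin a), Finset.sum_comm (γ := Fin a), Finset.sum_comm (γ := Fin a)]
    abel

end Actions

/-! ### The algebraic Bethe ansatz of rank one -/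

section RankOne

variable {X : Type*} [AddCommGroup X] [Module ℂ X]

/-- Stated for any pair with this exchange rule, so that it serves both diagonal entries: the second
one obeys it with `-c` in place of `c`. -/
theorem apply_prod_creation {c : ℂ} {S : Set ℂ} {A B : ℂ → Module.End ℂ X}
    (hAB : ∀ z ∈ S, ∀ p ∈ S, z ≠ p → ∀ x,
      A z (B p x) = f c p z • B p (A z x) + g c z p • B z (A p x))
    (hB : ∀ p ∈ S, ∀ q ∈ S, p ≠ q → ∀ x, B p (B q x) = B q (B p x))
    {b : ℕ} (v : Fin b → ℂ) (hv : Function.Injective v) (hvS : ∀ j, v j ∈ S) (z : ℂ) (hz : z ∈ S)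
    (hzv : ∀ j, z ≠ v j) (x : X) :
    A z ((List.ofFn fun j => B (v j)).prod x) =
      (∏ j, f c (v j) z) • (List.ofFn fun j => B (v j)).prod (A z x) +
      ∑ k, (g c z (v k) * ∏ j ∈ Finset.univ.erase k, f c (v j) (v k)) •
        (List.ofFn fun j => B (frontSubst z v k j)).prod (A (v k) x) := by
  induction b generalizing z with
  | zero => simp
  | succ b ih =>
    obtain ⟨p, v, rfl⟩ : ∃ p v', v = Fin.cons p v' := ⟨v 0, Fin.tail v, (Fin.cons_self_tail v).symm⟩
    have hp : p ∈ S := hvS 0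
    obtain ⟨hpv, hv'⟩ := Fin.cons_injective_iff.1 hv
    have hpv : ∀ k, p ≠ v k := fun k h => hpv ⟨k, h.symm⟩
    have hvS' : ∀ k, v k ∈ S := fun k => hvS k.succ
    have hzp : z ≠ p := hzv 0
    have hzv' : ∀ k, z ≠ v k := fun k => hzv k.succ
    have key : ∀ k : Fin b,
        (f c p z * (g c z (v k) * ∏ j ∈ Finset.univ.erase k, f c (v j) (v k))) •
          B p ((List.ofFn fun j => B (frontSubst z v k j)).prod (A (v k) x))
        + (g c z p * (g c p (v k) * ∏ j ∈ Finset.univ.erase k, f c (v j) (v k))) •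
          B z ((List.ofFn fun j => B (frontSubst p v k j)).prod (A (v k) x))
        = (g c z (v k) * (f c p (v k) * ∏ j ∈ Finset.univ.erase k, f c (v j) (v k))) •
          (List.ofFn fun j => B (frontSubst z (Fin.cons p v) k.succ j)).prod (A (v k) x) := by
      intro k
      cases b with
      | zero => exact k.elim0
      | succ b =>
        rw [frontSubst_succ]
        simp only [Fin.tail_cons, Fin.cons_zero, frontSubst, List.ofFn_succ, List.prod_cons,
          Fin.cons_succ, Module.End.mul_apply]
        rw [hB p hp z hz hzp.symm, ← add_smul]
        congr 1
        have := g_mul_g (c := c) hzp (hzv' k) (hpv k)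
        rw [f, f, g_antisymm c z p]
        linear_combination (-∏ j ∈ Finset.univ.erase k, f c (v j) (v k)) * this
    rw [Fin.prod_univ_succ, Fin.sum_univ_succ (n := b), prod_erase_zero, frontSubst_zero]
    simp only [prod_erase_succ, Fin.cons_zero, Fin.cons_succ, ← key, Fin.tail_cons]
    simp only [List.ofFn_succ, List.prod_cons, Fin.cons_zero, Fin.cons_succ,
      Module.End.mul_apply]
    rw [hAB z hz p hp hzp, ih v hv' hvS' z hz hzv', ih v hv' hvS' p hp hpv]
    simp only [map_add, map_sum, map_smul, smul_add, Finset.smul_sum, smul_smul,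
      Finset.sum_add_distrib]
    abel

/-- The unwanted terms of the two diagonal entries involve the same vectors, and the Bethe equations
make their coefficients opposite. The domain `S` is arbitrary, which later permits a matrix altered
at one point. -/
theorem bethe_rank_one {c : ℂ} {S : Set ℂ} {T : ℂ → Matrix (Fin 2) (Fin 2) (Module.End ℂ X)}
    (hT : ∀ z ∈ S, ∀ w ∈ S, z ≠ w → Exchange (g c z w) (T z) (T w)) {b : ℕ} (v : Fin b → ℂ)
    (hv : Function.Injective v) (hvS : ∀ j, v j ∈ S) (z : ℂ) (hz : z ∈ S) (hzv : ∀ j, z ≠ v j)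
    (x : X) (μ₁ μ₂ : ℂ → ℂ) (h₁ : ∀ w ∈ S, T w 0 0 x = μ₁ w • x)
    (h₂ : ∀ w ∈ S, T w 1 1 x = μ₂ w • x)
    (hbethe : ∀ j, μ₁ (v j) * ∏ i ∈ Finset.univ.erase j, f c (v i) (v j)
      = μ₂ (v j) * ∏ i ∈ Finset.univ.erase j, f c (v j) (v i)) :
    T z 0 0 ((List.ofFn fun j => T (v j) 0 1).prod x)
        + T z 1 1 ((List.ofFn fun j => T (v j) 0 1).prod x) =
      (μ₁ z * ∏ j, f c (v j) z + μ₂ z * ∏ j, f c z (v j)) •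
        (List.ofFn fun j => T (v j) 0 1).prod x := by
  have hneg : ∀ x y, g (-c) x y = g c y x := fun x y => by
    rw [g_antisymm c x y, g, g, neg_div]
  have hneg' : ∀ x y, f (-c) x y = f c y x := fun x y => by rw [f, f, hneg]
  -- The exchange relation only shows that `f(p,q)` times the commutator vanishes; if `f(p,q) = 0`,
  -- the order `q, p` is used.
  have hB : ∀ p ∈ S, ∀ q ∈ S, p ≠ q → ∀ x, T p 0 1 (T q 0 1 x) = T q 0 1 (T p 0 1 x) := by
    intro p hp q hq hpq x
    have h := fun p hp q hq hpq => LinearMap.congr_fun (hT p hp q hq hpq 0 1 0 1) x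
    have h' : ∀ p ∈ S, ∀ q ∈ S, p ≠ q →
        f c p q • (T p 0 1 (T q 0 1 x) - T q 0 1 (T p 0 1 x)) = 0 := by
      intro p hp q hq hpq
      have := h p hp q hq hpq
      simp only [LinearMap.add_apply, LinearMap.smul_apply, Module.End.mul_apply] at this
      rw [f]
      linear_combination (norm := module) (1 : ℂ) • this
    rcases f_ne_zero_or c p q with hf | hf
    · exact sub_eq_zero.1 ((smul_eq_zero_iff_right hf).1 (h' p hp q hq hpq))
    · exact (sub_eq_zero.1 ((smul_eq_zero_iff_right hf).1 (h' q hq p hp hpq.symm))).symm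
  have hA : ∀ z ∈ S, ∀ p ∈ S, z ≠ p → ∀ x, T z 0 0 (T p 0 1 x) =
      f c p z • T p 0 1 (T z 0 0 x) + g c z p • T z 0 1 (T p 0 0 x) := by
    intro z hz p hp hzp x
    have h := LinearMap.congr_fun (hT p hp z hz hzp.symm 0 1 0 0) x
    simp only [LinearMap.add_apply, LinearMap.smul_apply, Module.End.mul_apply] at h
    rw [f, g_antisymm c p z]
    linear_combination (norm := module) (-1 : ℂ) • h
  have hD : ∀ z ∈ S, ∀ p ∈ S, z ≠ p → ∀ x, T z 1 1 (T p 0 1 x) =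
      f (-c) p z • T p 0 1 (T z 1 1 x) + g (-c) z p • T z 0 1 (T p 1 1 x) := by
    intro z hz p hp hzp x
    have h := LinearMap.congr_fun (hT z hz p hp hzp 1 1 0 1) x
    simp only [LinearMap.add_apply, LinearMap.smul_apply, Module.End.mul_apply] at h
    rw [hneg, hneg', f, g_antisymm c z p]
    linear_combination (norm := module) (1 : ℂ) • h
  rw [apply_prod_creation hA hB v hv hvS z hz hzv, apply_prod_creation hD hB v hv hvS z hz hzv,
    h₁ z hz, h₂ z hz]
  simp only [h₁ _ (hvS _), h₂ _ (hvS _), hneg, hneg', map_smul, smul_smul]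
  have hk : ∀ k, (g c (v k) z * ∏ j ∈ Finset.univ.erase k, f c (v k) (v j)) * μ₂ (v k)
      = -((g c z (v k) * ∏ j ∈ Finset.univ.erase k, f c (v j) (v k)) * μ₁ (v k)) := by
    intro k
    rw [g_antisymm c z (v k)]
    linear_combination g c z (v k) * hbethe k
  simp only [hk, neg_smul, Finset.sum_neg_distrib]
  module

end RankOne

section Nested

variable {H : Type*} [AddCommGroup H] [Module ℂ H] {a : ℕ}

/-! ### The nested monodromy matrix and its residues -/

theorem exchange_nestedT {c : ℂ} {S : Set ℂ} {T : ℂ → Matrix (Fin 3) (Fin 3) (Module.End ℂ H)}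
    (hT : RTT c S T) (u : Fin a → ℂ) {z w : ℂ} (hz : z ∈ S) (hw : w ∈ S) (hzw : z ≠ w)
    (hzu : ∀ k, z ≠ u k) (hwu : ∀ k, w ≠ u k) :
    Exchange (g c z w) (nestedT c T u z) (nestedT c T u w) := by
  induction a with
  | zero =>
    intro i j k l
    refine LinearMap.ext fun x => funext fun s => ?_
    have h := LinearMap.congr_fun (hT.exchange hz hw hzw i.succ j.succ k.succ l.succ) (x s)
    simp only [LinearMap.add_apply, LinearMap.smul_apply, Module.End.mul_apply, Pi.add_apply,
      Pi.smul_apply, nestedT_zero] at h ⊢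
    exact h
  | succ a ih =>
    rw [nestedT_succ, nestedT_succ]
    refine (ih (Fin.tail u) (fun k => hzu k.succ) fun k => hwu k.succ).extendRight ?_
    rw [one_mul, one_mul]
    exact g_mul_g hzw (hzu 0) (hwu 0)

/-- The residue of the nested monodromy matrix at `w_1`, divided by `c`. -/
def residueT (c : ℂ) (T : ℂ → Matrix (Fin 3) (Fin 3) (Module.End ℂ H)) (w : Fin (a + 1) → ℂ) :
    Matrix (Fin 2) (Fin 2) (Module.End ℂ (AuxSpace H (a + 1))) :=
  extendRight (nestedT c T (Fin.tail w) (w 0)) 0 1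

/-- With `𝐩` in place of `r` at the first site, the condition of `exchange_siteL` reduces to the
antisymmetry of `g`. -/
theorem exchange_residueT {c : ℂ} {S : Set ℂ} {T : ℂ → Matrix (Fin 3) (Fin 3) (Module.End ℂ H)}
    (hT : RTT c S T) (w : Fin (a + 1) → ℂ) (hw : Function.Injective w) {z : ℂ} (hw0 : w 0 ∈ S)
    (hz : z ∈ S) (hzw : ∀ k, z ≠ w k) :
    Exchange (g c (w 0) z) (residueT c T w) (nestedT c T w z) ∧
      Exchange (g c z (w 0)) (nestedT c T w z) (residueT c T w) := by
  have h0 : ∀ k, w 0 ≠ Fin.tail w k := fun k h => Fin.succ_ne_zero k (hw h).symm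
  rw [nestedT_succ, residueT]
  refine ⟨(exchange_nestedT hT _ hw0 hz (hzw 0).symm h0 fun k => hzw k.succ).extendRight ?_,
    (exchange_nestedT hT _ hz hw0 (hzw 0) (fun k => hzw k.succ) h0).extendRight ?_⟩
  · rw [g_antisymm c (w 0) z]
    ring
  · ring

theorem slice_nestedVac (vac : H) (β : Fin 2) :
    slice β (nestedVac (a + 1) vac) = if β = 0 then nestedVac a vac else 0 := by
  funext s
  have : (Fin.cons β s : Fin (a + 1) → Fin 2) = 0 ↔ β = 0 ∧ s = 0 := by
    constructor
    · intro h
      exact ⟨congrFun h 0, funext fun k => congrFun h k.succ⟩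
    · rintro ⟨rfl, rfl⟩
      exact funext fun k => Fin.cases rfl (fun _ => rfl) k
  by_cases h : β = 0
  · subst h
    simp [slice_apply, nestedVac, this]
  · simp [slice_apply, nestedVac, this, h]

theorem extendRight_nestedVac {N : Matrix (Fin 2) (Fin 2) (Module.End ℂ (AuxSpace H a))} {vac : H}
    {μ₁ μ₂ : ℂ} (h₁ : N 0 0 (nestedVac a vac) = μ₁ • nestedVac a vac)
    (h₂ : N 1 1 (nestedVac a vac) = μ₂ • nestedVac a vac) (h₃ : N 1 0 (nestedVac a vac) = 0)
    (p q : ℂ) :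
    extendRight N p q 0 0 (nestedVac (a + 1) vac) = (μ₁ * (p + q)) • nestedVac (a + 1) vac ∧
    extendRight N p q 1 1 (nestedVac (a + 1) vac) = (μ₂ * p) • nestedVac (a + 1) vac ∧
    extendRight N p q 1 0 (nestedVac (a + 1) vac) = 0 := by
  refine ⟨slice_ext fun β => ?_, slice_ext fun β => ?_, slice_ext fun β => ?_⟩ <;>
    fin_cases β <;> simp [slice_extendRight, slice_nestedVac, h₁, h₂, h₃] <;> module

theorem nestedT_nestedVac {c : ℂ} {S : Set ℂ}
    {T : ℂ → Matrix (Fin 3) (Fin 3) (Module.End ℂ H)} {vac : H} {lam : Fin 3 → ℂ → ℂ}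
    (hT : IsGL3Model c S T vac lam) (u : Fin a → ℂ) {z : ℂ} (hz : z ∈ S) :
    nestedT c T u z 0 0 (nestedVac a vac) = (lam 1 z * ∏ k, f c z (u k)) • nestedVac a vac ∧
    nestedT c T u z 1 1 (nestedVac a vac) = lam 2 z • nestedVac a vac ∧
    nestedT c T u z 1 0 (nestedVac a vac) = 0 := by
  induction a with
  | zero =>
    refine ⟨?_, ?_, ?_⟩ <;> funext s <;> rw [nestedT_zero] <;>
      simp [blockD, nestedVac, Subsingleton.elim s 0]
    · exact hT.diag z hz 1
    · exact hT.diag z hz 2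
    · exact hT.lower z hz 2 1 (by decide)
  | succ a ih =>
    obtain ⟨h₁, h₂, h₃⟩ := ih (Fin.tail u)
    have := extendRight_nestedVac h₁ h₂ h₃ 1 (g c z (u 0))
    rw [nestedT_succ, Fin.prod_univ_succ]
    rw [mul_one] at this
    rw [mul_comm (f c z (u 0)), ← mul_assoc]
    exact this

/-- The vectors on which `T₁₁(w)` acts as `λ₁(w)` and which `T₂₁(w)`, `T₃₁(w)` annihilate, for
all `w ∈ A`. -/
def singularVectors (T : ℂ → Matrix (Fin 3) (Fin 3) (Module.End ℂ H)) (lam : Fin 3 → ℂ → ℂ)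
    (A : Set ℂ) : Submodule ℂ H where
  carrier := {x | ∀ w ∈ A, T w 0 0 x = lam 0 w • x ∧ ∀ i : Fin 2, T w i.succ 0 x = 0}
  add_mem' hx hy w hw := by
    simp [(hx w hw).1, (hy w hw).1, (hx w hw).2, (hy w hw).2]
  zero_mem' w _ := by simp
  smul_mem' r x hx w hw := by
    simp [(hx w hw).1, (hx w hw).2, smul_comm r]

/-- In the exchange relation of `𝔻(z)` with the first column of `T(w)`, the extra terms end in `T₂₁`
or `T₃₁` and vanish on `x`. The point `z` is removed because the relation requires `w ≠ z`. -/
theorem blockD_mem_singularVectors {c : ℂ} {S : Set ℂ}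
    {T : ℂ → Matrix (Fin 3) (Fin 3) (Module.End ℂ H)} (hT : RTT c S T) {lam : Fin 3 → ℂ → ℂ}
    {A : Set ℂ} (hAS : A ⊆ S) {z : ℂ} (hz : z ∈ A) (α β : Fin 2) {x : H}
    (hx : x ∈ singularVectors T lam A) :
    blockD T z α β x ∈ singularVectors T lam (A \ {z}) := by
  rintro w ⟨hw, hwz⟩
  have h := fun i => LinearMap.congr_fun
    (hT.exchange (hAS hz) (hAS hw) (Ne.symm hwz) α.succ β.succ i 0) x
  simp only [LinearMap.add_apply, LinearMap.smul_apply, Module.End.mul_apply, (hx w hw).2,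
    (hx z hz).2, map_zero, smul_zero, add_zero] at h
  refine ⟨?_, fun i => ?_⟩
  · have := h 0
    rw [(hx w hw).1, map_smul] at this
    exact this.symm
  · have := h i.succ
    rw [(hx w hw).2, map_zero] at this
    exact this.symm

theorem nestedT_mem_singularVectors {c : ℂ} {S : Set ℂ}
    {T : ℂ → Matrix (Fin 3) (Fin 3) (Module.End ℂ H)} (hT : RTT c S T) {lam : Fin 3 → ℂ → ℂ}
    {A : Set ℂ} (hAS : A ⊆ S) {z : ℂ} (hz : z ∈ A) (u : Fin a → ℂ) (α β : Fin 2)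
    {x : AuxSpace H a} (hx : ∀ s, x s ∈ singularVectors T lam A) (s : Fin a → Fin 2) :
    nestedT c T u z α β x s ∈ singularVectors T lam (A \ {z}) := by
  induction a generalizing β with
  | zero =>
    rw [nestedT_zero]
    exact blockD_mem_singularVectors hT hAS hz α β (hx s)
  | succ a ih =>
    rw [← Fin.cons_self_tail s, ← slice_apply (s 0) (nestedT c T u z α β x), nestedT_succ,
      slice_extendRight]
    have hm := fun β γ => ih (Fin.tail u) β (x := slice γ x) (fun s => hx _) (Fin.tail s)
    refine Submodule.add_mem _ (Submodule.smul_mem _ _ (hm _ _)) ?_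
    split_ifs
    · refine Submodule.smul_mem _ _ ?_
      rw [Finset.sum_apply]
      exact Submodule.sum_mem _ fun ε _ => hm _ _
    · exact Submodule.zero_mem _

theorem nestedVector_mem_singularVectors {b : ℕ} {c : ℂ} {S : Set ℂ}
    {T : ℂ → Matrix (Fin 3) (Fin 3) (Module.End ℂ H)} {vac : H} {lam : Fin 3 → ℂ → ℂ}
    (hT : IsGL3Model c S T vac lam) (u : Fin a → ℂ) (v : Fin b → ℂ) (hv : Function.Injective v)
    (hvS : ∀ j, v j ∈ S) (s : Fin a → Fin 2) :
    nestedVector c T vac u v s ∈ singularVectors T lam (S \ Set.range v) := by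
  induction b generalizing s with
  | zero =>
    have : vac ∈ singularVectors T lam (S \ Set.range v) := fun w hw =>
      ⟨hT.diag w hw.1 0, fun i => hT.lower w hw.1 _ _ (Fin.succ_pos i)⟩
    by_cases h : s = 0
    · simpa [nestedVector, nestedVac, h] using this
    · simp [nestedVector, nestedVac, h]
  | succ b ih =>
    rw [nestedVector_succ, nestedB]
    have hS : S \ Set.range v = (S \ Set.range (Fin.tail v)) \ {v 0} := by
      ext w
      simp only [Set.mem_sdiff, Set.mem_range, Set.mem_singleton_iff, Fin.exists_fin_succ, Fin.tail]
      tauto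
    rw [hS]
    refine nestedT_mem_singularVectors hT.rtt Set.sdiff_subset ⟨hvS 0, ?_⟩ u 0 1
      (ih (Fin.tail v) (hv.comp (Fin.succ_injective _)) fun j => hvS _) s
    rintro ⟨j, hj⟩
    exact Fin.succ_ne_zero j (hv hj)

/-! ### Symmetry in `ū` -/

theorem Covariant.mono {c : ℂ} {A A' : Set ℂ} {F : (Fin a → ℂ) → AuxSpace H a}
    (hF : Covariant c A F) (h : A' ⊆ A) : Covariant c A' F := fun u hu hA =>
  hF u hu fun k => h (hA k)

/-- For adjacent transpositions, `row_twist` and covariance give the equality multiplied by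
`f(u_i,u_j)`, and likewise by `f(u_j,u_i)`; one of these is nonzero. Adjacent transpositions
generate all permutations. -/
theorem Covariant.row_comp_perm {c : ℂ} {S : Set ℂ}
    {T : ℂ → Matrix (Fin 3) (Fin 3) (Module.End ℂ H)} (hT : RTT c S T) {A : Set ℂ} (hAS : A ⊆ S)
    {F : (Fin a → ℂ) → AuxSpace H a} (hF : Covariant c A F) (σ : Equiv.Perm (Fin a))
    (u : Fin a → ℂ) (hu : Function.Injective u) (huA : ∀ k, u k ∈ A) :
    row T (u ∘ σ) (F (u ∘ σ)) = row T u (F u) := by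
  have hadj : ∀ i j : Fin a, (j : ℕ) = i + 1 → ∀ u : Fin a → ℂ, Function.Injective u →
      (∀ k, u k ∈ A) →
      row T (u ∘ Equiv.swap i j) (F (u ∘ Equiv.swap i j)) = row T u (F u) := by
    intro i j hij u hu huA
    have hne : i ≠ j := fun h => by
      rw [h] at hij
      omega
    have h : ∀ u : Fin a → ℂ, Function.Injective u → (∀ k, u k ∈ A) →
        f c (u i) (u j) • (row T (u ∘ Equiv.swap i j) (F (u ∘ Equiv.swap i j)) - row T u (F u))
          = 0 := by
      intro u hu huA
      rw [smul_sub, row_twist hT i j hij u (fun k => hAS (huA k)) (hu.ne hne), hF u hu huA i j hij,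
        map_smul, sub_self]
    have h1 := h u hu huA
    have h2 := h (u ∘ Equiv.swap i j) (hu.comp (Equiv.injective _)) fun k => huA _
    simp only [Function.comp_apply, Equiv.swap_apply_left, Equiv.swap_apply_right] at h2
    have h3 : (u ∘ Equiv.swap i j) ∘ Equiv.swap i j = u := by
      funext k
      simp
    rw [h3] at h2
    rcases f_ne_zero_or c (u i) (u j) with hf | hf
    · exact sub_eq_zero.1 ((smul_eq_zero_iff_right hf).1 h1)
    · exact (sub_eq_zero.1 ((smul_eq_zero_iff_right hf).1 h2)).symm
  cases a with
  | zero => rw [Subsingleton.elim (u ∘ σ) u]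
  | succ a =>
    have hσ : σ ∈ Submonoid.closure
        (Set.range fun i : Fin a => Equiv.swap i.castSucc i.succ) := by
      rw [Equiv.Perm.mclosure_swap_castSucc_succ]
      trivial
    induction hσ using Submonoid.closure_induction generalizing u with
    | mem τ hτ =>
      obtain ⟨i, rfl⟩ := hτ
      exact hadj _ _ (by simp) u hu huA
    | one => rfl
    | mul τ τ' _ _ h h' =>
      rw [Equiv.Perm.coe_mul, ← Function.comp_assoc,
        h' (u ∘ τ) (hu.comp τ.injective) fun k => huA _, h u hu huA]

/-- After the first position, exchanging `u_1` with `u_k` and deleting `u_k` list the same variables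
in different orders. Each slice along the first site is covariant, so the order is immaterial. -/
theorem unwantedVector_eq {b : ℕ} {c : ℂ} {S : Set ℂ}
    {T : ℂ → Matrix (Fin 3) (Fin 3) (Module.End ℂ H)} (hT : RTT c S T) (vac : H) (z : ℂ)
    (u : Fin a → ℂ) (v : Fin b → ℂ) (hu : Function.Injective u) (huS : ∀ k, u k ∈ S)
    (huv : ∀ k j, u k ≠ v j) (k : Fin a) :
    unwantedVector c T vac z u v k =
      row T (frontSubst z u k) (nestedVector c T vac (frontSubst (u k) u k) v) := by
  cases a with
  | zero => exact k.elim0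
  | succ a =>
    simp only [unwantedVector, rowApply_eq_row, frontSubst]
    change row T (Function.update (u ∘ Equiv.swap 0 k) 0 z)
      (nestedVector c T vac (u ∘ Equiv.swap 0 k) v) = _
    have hex : ∀ i : Fin a, ∃ j, k.succAbove j = Equiv.swap 0 k i.succ := fun i =>
      Fin.exists_succAbove_eq fun h => Fin.succ_ne_zero i
        ((Equiv.swap 0 k).injective (h.trans (Equiv.swap_apply_left 0 k).symm))
    choose σ hσ using hex
    have hσi : Function.Injective σ := fun i j h => by
      have := congrArg k.succAbove h
      rw [hσ, hσ] at this
      exact Fin.succ_injective _ ((Equiv.swap 0 k).injective this)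
    let τ : Equiv.Perm (Fin a) := Equiv.ofBijective σ (Finite.injective_iff_bijective.1 hσi)
    have hu' : u ∘ Equiv.swap 0 k = Fin.cons (u k) (k.removeNth u ∘ τ) := by
      funext i
      refine Fin.cases ?_ (fun i => ?_) i
      · simp
      · change u _ = u (k.succAbove (σ i))
        rw [hσ]
    rw [hu', Fin.update_cons_zero, row_succ, row_succ]
    simp only [Fin.cons_zero, Fin.tail_cons]
    refine Finset.sum_congr rfl fun β _ => ?_
    refine congrArg _ ?_
    have hcov := ((covariant_nestedVector (a := a + 1) c T vac v).mono
      (Set.inter_subset_right (s := S))).slice (p := u k) ⟨huS k, fun ⟨j, hj⟩ => huv k j hj.symm⟩ β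
    refine hcov.row_comp_perm hT (Set.sdiff_subset.trans Set.inter_subset_left) τ (k.removeNth u)
      (fun i j h => Fin.succAbove_right_injective (hu h)) fun i => ⟨⟨huS _, ?_⟩, ?_⟩
    · exact fun ⟨j, hj⟩ => huv _ j hj.symm
    · exact fun h => Fin.succAbove_ne k i (hu h)

/-! ### The action of the nested transfer matrix on the nested Bethe vector -/

theorem nestedT_trace_nestedVector {b : ℕ} {c : ℂ} {S : Set ℂ}
    {T : ℂ → Matrix (Fin 3) (Fin 3) (Module.End ℂ H)} {vac : H} {lam : Fin 3 → ℂ → ℂ}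
    (hT : IsGL3Model c S T vac lam) (u : Fin a → ℂ) (v : Fin b → ℂ) (hvS : ∀ j, v j ∈ S)
    (hv : Function.Injective v) (huv : ∀ k j, u k ≠ v j) (hV : BetheEqV c lam u v) {z : ℂ}
    (hz : z ∈ S) (hzu : ∀ k, z ≠ u k) (hzv : ∀ j, z ≠ v j) :
    ∑ α, nestedT c T u z α α (nestedVector c T vac u v) =
      (lam 1 z * (∏ k, f c z (u k)) * ∏ j, f c (v j) z + lam 2 z * ∏ j, f c z (v j)) •
        nestedVector c T vac u v := by
  have hS : ∀ w ∈ S \ Set.range u, ∀ k, w ≠ u k := fun w hw k h => hw.2 ⟨k, h.symm⟩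
  rw [Fin.sum_univ_two]
  refine bethe_rank_one (S := S \ Set.range u)
    (fun z hz w hw hzw => exchange_nestedT hT.rtt u hz.1 hw.1 hzw (hS z hz) (hS w hw)) v hv
    (fun j => ⟨hvS j, fun ⟨k, hk⟩ => huv k j hk⟩) z ⟨hz, fun ⟨k, hk⟩ => hzu k hk.symm⟩ hzv _
    (fun z => lam 1 z * ∏ k, f c z (u k)) (lam 2)
    (fun w hw => (nestedT_nestedVac hT u hw.1).1)
    (fun w hw => (nestedT_nestedVac hT u hw.1).2.1) fun j => ?_
  linear_combination hV j

/-- The rank-one theorem is applied to the nested monodromy matrix with its value at `w_1` replaced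
by the residue, on the domain consisting of `w_1` and `v̄`. There `μ₂(w_1) = 0`, since the `λ₃`
eigenvalue on the nested vacuum has no factor singular at `w_1`. -/
theorem residueT_trace_nestedVector {b : ℕ} {c : ℂ} {S : Set ℂ}
    {T : ℂ → Matrix (Fin 3) (Fin 3) (Module.End ℂ H)} {vac : H} {lam : Fin 3 → ℂ → ℂ}
    (hT : IsGL3Model c S T vac lam) (w : Fin (a + 1) → ℂ) (v : Fin b → ℂ) (hw0 : w 0 ∈ S)
    (hvS : ∀ j, v j ∈ S) (hw : Function.Injective w) (hv : Function.Injective v)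
    (hwv : ∀ k j, w k ≠ v j) (hV : BetheEqV c lam w v) :
    ∑ α, residueT c T w α α (nestedVector c T vac w v) =
      (lam 1 (w 0) * (∏ k, f c (w 0) (Fin.tail w k)) * ∏ j, f c (v j) (w 0)) •
        nestedVector c T vac w v := by
  set T' := Function.update (nestedT c T w) (w 0) (residueT c T w) with hT'
  have h0 : T' (w 0) = residueT c T w := Function.update_self _ _ _
  have hj : ∀ j, T' (v j) = nestedT c T w (v j) := fun j =>
    Function.update_of_ne (hwv 0 j).symm _ _
  let μ₁ : ℂ → ℂ := fun z => if z = w 0 then lam 1 (w 0) * ∏ k, f c (w 0) (Fin.tail w k)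
    else lam 1 z * ∏ k, f c z (w k)
  let μ₂ : ℂ → ℂ := fun z => if z = w 0 then 0 else lam 2 z
  obtain ⟨r₁, r₂, r₃⟩ := nestedT_nestedVac hT (Fin.tail w) hw0
  obtain ⟨r₁, r₂, -⟩ := extendRight_nestedVac r₁ r₂ r₃ 0 1
  rw [zero_add, mul_one] at r₁
  rw [mul_zero] at r₂
  have key := bethe_rank_one (c := c) (S := insert (w 0) (Set.range v)) (T := T')
    (v := v) (z := w 0) (x := nestedVac (a + 1) vac) (μ₁ := μ₁) (μ₂ := μ₂) ?_ hv
    (fun j => Or.inr ⟨j, rfl⟩) (Or.inl rfl) (hwv 0) ?_ ?_ ?_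
  · simp only [h0, hj, μ₁, μ₂, if_true, zero_mul, add_zero] at key
    rw [Fin.sum_univ_two]
    exact key
  · rintro _ (rfl | ⟨i, rfl⟩) _ (rfl | ⟨j, rfl⟩) hne
    · exact absurd rfl hne
    · rw [h0, hj]
      exact (exchange_residueT hT.rtt w hw hw0 (hvS j) fun k => (hwv k j).symm).1
    · rw [h0, hj]
      exact (exchange_residueT hT.rtt w hw hw0 (hvS i) fun k => (hwv k i).symm).2
    · rw [hj, hj]
      exact exchange_nestedT hT.rtt w (hvS i) (hvS j) hne (fun k => (hwv k i).symm)
        fun k => (hwv k j).symm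
  · rintro _ (rfl | ⟨j, rfl⟩)
    · simpa only [h0, μ₁, if_true, residueT] using r₁
    · simpa only [hj, μ₁, if_neg (hwv 0 j).symm] using (nestedT_nestedVac hT w (hvS j)).1
  · rintro _ (rfl | ⟨j, rfl⟩)
    · simpa only [h0, μ₂, if_true, residueT] using r₂
    · simpa only [hj, μ₂, if_neg (hwv 0 j).symm] using (nestedT_nestedVac hT w (hvS j)).2.1
  · intro j
    simp only [μ₁, μ₂, if_neg (hwv 0 j).symm]
    linear_combination hV j

theorem betheEqV_frontSubst {b : ℕ} {c : ℂ} {lam : Fin 3 → ℂ → ℂ} {u : Fin a → ℂ} {v : Fin b → ℂ}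
    (hV : BetheEqV c lam u v) (k : Fin a) : BetheEqV c lam (frontSubst (u k) u k) v := by
  cases a with
  | zero => exact k.elim0
  | succ a =>
    intro j
    have := hV j
    rw [Fin.prod_univ_succAbove _ k] at this
    rw [Fin.prod_univ_succ]
    exact this

end Nested

/-! ### The off-shell action of the transfer matrix -/

section Main

variable {H : Type*} [AddCommGroup H] [Module ℂ H] {a b : ℕ}

/-- Antisymmetry of `g` exhibits the coefficient as `g(z,u_k)` times the difference of the two sides
of (U); the equivalence with (U) and the on-shell statement both rest on this. -/
theorem unwantedCoeff_eq (c : ℂ) (lam : Fin 3 → ℂ → ℂ) (u : Fin a → ℂ) (v : Fin b → ℂ) (z : ℂ)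
    (k : Fin a) : unwantedCoeff c lam u v z k =
      g c z (u k) * (lam 0 (u k) * ∏ i ∈ Finset.univ.erase k, f c (u i) (u k)
        - lam 1 (u k) * (∏ i ∈ Finset.univ.erase k, f c (u k) (u i)) * ∏ j, f c (v j) (u k)) := by
  rw [unwantedCoeff, g_antisymm c z (u k)]
  ring

theorem prod_removeNth_eq (k : Fin (a + 1)) (φ : Fin (a + 1) → ℂ) :
    ∏ i, φ (k.succAbove i) = ∏ i ∈ Finset.univ.erase k, φ i := by
  rw [prod_erase_eq, Fin.prod_univ_succAbove _ k]
  simp [Fin.succAbove_ne]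

/-- Summed over the diagonal, the vectors `residue` produced by `blockD_row` form the trace of
`residueT`, whose eigenvalue is known. -/
theorem sum_residue_nestedVector {c : ℂ} {S : Set ℂ}
    {T : ℂ → Matrix (Fin 3) (Fin 3) (Module.End ℂ H)} {vac : H} {lam : Fin 3 → ℂ → ℂ}
    (hT : IsGL3Model c S T vac lam) (u : Fin a → ℂ) (v : Fin b → ℂ) (huS : ∀ k, u k ∈ S)
    (hvS : ∀ j, v j ∈ S) (hu : Function.Injective u) (hv : Function.Injective v)
    (huv : ∀ k j, u k ≠ v j) (hV : BetheEqV c lam u v) (k : Fin a) :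
    ∑ α, residue c T α (frontSubst (u k) u k)
        (fun γ => if γ = α then nestedVector c T vac (frontSubst (u k) u k) v else 0) =
      (lam 1 (u k) * (∏ i ∈ Finset.univ.erase k, f c (u k) (u i)) * ∏ j, f c (v j) (u k)) •
        nestedVector c T vac (frontSubst (u k) u k) v := by
  have hV' := betheEqV_frontSubst hV k
  have hw : Function.Injective (frontSubst (u k) u k) := by
    cases a with
    | zero => exact k.elim0
    | succ a =>
      refine Fin.cons_injective_iff.2 ⟨?_, fun i j h => Fin.succAbove_right_injective (hu h)⟩
      rintro ⟨i, hi⟩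
      exact Fin.succAbove_ne k i (hu hi)
  have hwv : ∀ i j, frontSubst (u k) u k i ≠ v j := fun i j h =>
    forall_mem_frontSubst (A := (Set.range v)ᶜ) (fun ⟨j, hj⟩ => huv k j hj.symm)
      (fun i ⟨j, hj⟩ => huv i j hj.symm) k i ⟨j, h.symm⟩
  cases a with
  | zero => exact k.elim0
  | succ a =>
    have h := residueT_trace_nestedVector hT (frontSubst (u k) u k) v (huS k) hvS hw hv hwv hV'
    rw [← prod_removeNth_eq]
    refine Eq.trans (slice_ext fun β => ?_) h
    simp only [residue, residueT, map_sum, slice_unslice, slice_extendRight, zero_smul, zero_add,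
      one_smul, apply_ite (slice _), map_zero, Finset.sum_ite_eq, Finset.mem_univ, if_true]
    rw [Finset.sum_eq_single β]
    · simp
    · intro α _ hα
      simp [hα.symm]
    · simp

theorem transfer_betheVector {c : ℂ} {S : Set ℂ}
    {T : ℂ → Matrix (Fin 3) (Fin 3) (Module.End ℂ H)} {vac : H} {lam : Fin 3 → ℂ → ℂ}
    (hT : IsGL3Model c S T vac lam) (u : Fin a → ℂ) (v : Fin b → ℂ) (huS : ∀ k, u k ∈ S)
    (hvS : ∀ j, v j ∈ S) (hu : Function.Injective u) (hv : Function.Injective v)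
    (huv : ∀ k j, u k ≠ v j) (hV : BetheEqV c lam u v) {z : ℂ} (hz : z ∈ S) (hzu : ∀ k, z ≠ u k)
    (hzv : ∀ j, z ≠ v j) :
    transfer T z (betheVector c T vac u v) =
      eigenvalue c lam u v z • betheVector c T vac u v +
        ∑ k, unwantedCoeff c lam u v z k • unwantedVector c T vac z u v k := by
  simp only [unwantedVector_eq hT.rtt vac z u v hu huS huv]
  set F : (Fin a → ℂ) → AuxSpace H a := fun w => nestedVector c T vac w v with hFdef
  have hF : Covariant c (S \ Set.range v) F := (covariant_nestedVector c T vac v).mono fun _ h => h.2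
  have huA : ∀ k, u k ∈ S \ Set.range v := fun k => ⟨huS k, fun ⟨j, hj⟩ => huv k j hj.symm⟩
  have hA : ∀ w ∈ S \ Set.range v, ∀ w', (T w 0 0).compLeft _ (F w') = lam 0 w • F w' :=
    fun w hw w' => funext fun s => (nestedVector_mem_singularVectors hT w' v hv hvS s w hw).1
  have h₁ := T00_row hT.rtt F _ Set.sdiff_subset hF u hu huA z hz hzu
  simp only [hA _ (huA _), hA z ⟨hz, fun ⟨j, hj⟩ => hzv j hj.symm⟩, map_smul, smul_smul] at h₁
  have hcov : ∀ α γ : Fin 2, Covariant c (S \ Set.range v) fun w => if γ = α then F w else 0 := by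
    intro α γ
    split_ifs
    · exact hF
    · intro w _ _ i j _
      simp
  -- The Kronecker delta selects the entry `(α,α)` of `𝔻`, and summing over `α` gives the trace.
  have h₂ := fun α => blockD_row hT.rtt α (fun γ w => if γ = α then F w else 0) _
    Set.sdiff_subset (hcov α) u hu huA z hz hzu
  have h₃ : ∑ α, blockD T z α α (row T u (F u)) =
      row T u (∑ α, nestedT c T u z α α (F u)) + ∑ k, g c (u k) z • row T (frontSubst z u k)
        (∑ α, residue c T α (frontSubst (u k) u k)
          fun γ => if γ = α then F (frontSubst (u k) u k) else 0) := by
    have := Finset.sum_congr rfl fun α (_ : α ∈ Finset.univ) => h₂ α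
    simp only [apply_ite (row T u), map_zero, apply_ite (blockD T z _ _),
      apply_ite (nestedT c T u z _ _), Finset.sum_ite_eq', Finset.mem_univ, if_true,
      Finset.sum_add_distrib] at this
    rw [this, map_sum, Finset.sum_comm]
    simp only [map_sum, Finset.smul_sum]
  rw [nestedT_trace_nestedVector hT u v hvS hv huv hV hz hzu hzv] at h₃
  simp only [hFdef, sum_residue_nestedVector hT u v huS hvS hu hv huv hV, map_smul,
    smul_smul] at h₃
  have htr : ∀ x, transfer T z x = T z 0 0 x + ∑ α, blockD T z α α x := by
    intro x
    simp [transfer, Matrix.trace, Fin.sum_univ_succ, blockD]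
  rw [betheVector, rowApply_eq_row, htr]
  simp only [hFdef] at h₁
  rw [h₁, h₃, eigenvalue]
  have hk : ∀ k, unwantedCoeff c lam u v z k =
      g c z (u k) * (∏ i ∈ Finset.univ.erase k, f c (u i) (u k)) * lam 0 (u k)
      + g c (u k) z * (lam 1 (u k) * (∏ i ∈ Finset.univ.erase k, f c (u k) (u i))
        * ∏ j, f c (v j) (u k)) := by
    intro k
    rw [unwantedCoeff]
    ring
  simp only [hk, add_smul, Finset.sum_add_distrib]
  module

end Main

end NABA

end

theorem mainTheorem2 {H : Type*} [AddCommGroup H] [Module ℂ H] (c : ℂ) (S : Set ℂ)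
    (T : ℂ → Matrix (Fin 3) (Fin 3) (Module.End ℂ H)) (vac : H) (lam : Fin 3 → ℂ → ℂ)
    (hT : NABA.IsGL3Model c S T vac lam) (a b : ℕ) (u : Fin a → ℂ) (v : Fin b → ℂ)
    (huS : ∀ k, u k ∈ S) (hvS : ∀ j, v j ∈ S)
    (hu : Function.Injective u) (hv : Function.Injective v) (huv : ∀ k j, u k ≠ v j)
    (hBetheV : NABA.BetheEqV c lam u v) :
    (∀ z ∈ S, z ∉ Set.range u → z ∉ Set.range v →
      NABA.transfer T z (NABA.betheVector c T vac u v) =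
        NABA.eigenvalue c lam u v z • NABA.betheVector c T vac u v +
          ∑ k : Fin a, NABA.unwantedCoeff c lam u v z k •
            NABA.unwantedVector c T vac z u v k) ∧
    (c ≠ 0 → ∀ z : ℂ, z ∉ Set.range u →
      ((∀ k, NABA.unwantedCoeff c lam u v z k = 0) ↔ NABA.BetheEqU c lam u v)) ∧
    (NABA.BetheEqU c lam u v → ∀ z ∈ S, z ∉ Set.range u → z ∉ Set.range v →
      NABA.transfer T z (NABA.betheVector c T vac u v) =
        NABA.eigenvalue c lam u v z • NABA.betheVector c T vac u v ∧
      (NABA.betheVector c T vac u v ≠ 0 →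
        Module.End.HasEigenvector (NABA.transfer T z) (NABA.eigenvalue c lam u v z)
          (NABA.betheVector c T vac u v))) := by
  have h₁ : ∀ z ∈ S, z ∉ Set.range u → z ∉ Set.range v → _ := fun z hz hzu hzv =>
    NABA.transfer_betheVector hT u v huS hvS hu hv huv hBetheV hz
      (fun k h => hzu ⟨k, h.symm⟩) fun j h => hzv ⟨j, h.symm⟩
  refine ⟨h₁, fun hc z hzu => forall_congr' fun k => ?_, fun hU z hz hzu hzv => ?_⟩
  · have hg : NABA.g c z (u k) ≠ 0 :=
      div_ne_zero hc (sub_ne_zero.2 fun h => hzu ⟨k, h.symm⟩)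
    rw [NABA.unwantedCoeff_eq, mul_eq_zero, or_iff_right hg, sub_eq_zero]
  · have h := h₁ z hz hzu hzv
    simp only [NABA.unwantedCoeff_eq, hU _, sub_self, mul_zero, zero_smul, Finset.sum_const_zero,
      add_zero] at h
    exact ⟨h, fun hne => ⟨Module.End.mem_eigenspace_iff.2 h, hne⟩⟩
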